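/- Let $G$ be a finite group, $p$ a prime with $p\nmid |G|$, and $r\ge 1$. Write $x^g=g^{-1}xg$, let $\operatorname{Cen}_G(x)=\{g\in G : x^g=x\}$ for $x$ in a group ring of $G$, and let $\widehat{L}=|L|^{-1}\sum_{x\in L}x$ for $L\le G$. A Shoda pair of $G$ is a pair $(H,K)$ of subgroups with $K\trianglelefteq H$ and $H/K$ cyclic such that, for every $g\in G$, $\{h^{-1}g^{-1}hg : h\in H\}\cap H\subseteq K$ implies $g\in H$. Put $\varepsilon(H,K)=\widehat K\in\mathbb{Q}G$ if $H=K$, and otherwise $\varepsilon(H,K)=\prod_L(\widehat K-\widehat L)$, where $L/K$ runs over the minimal non-trivial normal subgroups of $H/K$. A Shoda pair is strong if $H\trianglelefteq N_G(K)$, $H/K$ is a maximal abelian subgroup of $N_G(K)/K$, and $\varepsilon(H,K)\,\varepsilon(H,K)^g=0$ for all $g\in G\setminus N_G(K)$. Let $(H,K)$ be a strong Shoda pair of $G$, $k=[H:K]$, and $\xi_k$ a primitive $k$-th root of unity in $\overline{\mathbb{F}}_p$. Let $\mathcal{C}_p(H/K)$ be the set of those orbits of $\operatorname{Gal}(\mathbb{F}_p(\xi_k)/\mathbb{F}_p)$,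 acting by composition on the group $\operatorname{Irr}(H/K)$ of linear characters $H/K\to\overline{\mathbb{F}}_p^{\,\times}$, that contain a generator of $\operatorname{Irr}(H/K)$. The group $N_G(K)$ acts on $\mathcal{C}_p(H/K)$ through $\chi^g(hK)=\chi(ghg^{-1}K)$. For $C\in\mathcal{C}_p(H/K)$ and any $\chi\in C$ let $$\varepsilon_C(H,K)=|H|^{-1}\sum_{h\in H}\operatorname{tr}_{\mathbb{F}_p(\xi_k)/\mathbb{F}_p}(\chi(hK))\,h^{-1}\in\mathbb{F}_pH,$$ let $e_C(G,H,K)$ be the sum of the distinct $G$-conjugates of $\varepsilon_C(H,K)$, and let $$\omega_C(H,K)=\Bigl(\sum_{j=1}^{n}(-1)^{j-1}\tbinom{n}{j}a^j\Bigr)^n\in\mathbb{Z}_{p^r}H,$$ where $a\in\mathbb{Z}_{p^r}H$ is $\varepsilon_C(H,K)$ with its coefficients read as $0,1,\dots,p-1$, and $n$ is the nilpotency index of $a-a^2$. Let $w_C(G,H,K)\in\mathbb{Z}_{p^r}G$ be the sum of the distinct $G$-conjugates of $\omega_C(H,K)$. Then: (i) for every $C\in\mathcal{C}_p(H/K)$,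 $\operatorname{Cen}_G(\omega_C(H,K))=\operatorname{Cen}_G(\varepsilon_C(H,K))$, and the coefficientwise reduction of $w_C(G,H,K)$ modulo $p$ is $e_C(G,H,K)$; (ii) for every $C\in\mathcal{C}_p(H/K)$, $w_C(G,H,K)$ is a primitive central idempotent of $\mathbb{Z}_{p^r}G$ (a nonzero central idempotent that is not a sum of two nonzero orthogonal central idempotents). For $C,C'\in\mathcal{C}_p(H/K)$, $w_C(G,H,K)=w_{C'}(G,H,K)$ if and only if $C'=C^g$ for some $g\in N_G(K)$; and if $w_C(G,H,K)\ne w_{C'}(G,H,K)$, then $w_C(G,H,K)\,w_{C'}(G,H,K)=0$. In particular, the $w_C(G,H,K)$, with $C$ running over representatives of the $N_G(K)$-orbits on $\mathcal{C}_p(H/K)$, are distinct and pairwise orthogonal. -/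

import Mathlib

open scoped Classical

noncomputable section

namespace ShodaLift

/-! ### Generalities on group rings -/

/-- The conjugate `g⁻¹ x g` of an element `x` of the group ring `RG` by `g ∈ G`. -/
def conj {R G : Type*} [CommRing R] [Group G] (g : G) (x : MonoidAlgebra R G) :
    MonoidAlgebra R G :=
  MonoidAlgebra.single g⁻¹ 1 * x * MonoidAlgebra.single g 1

/-- `Cen_G(x) = {g ∈ G | g⁻¹ x g = x}` for `x ∈ RG`. -/
def cen {R G : Type*} [CommRing R] [Group G] (x : MonoidAlgebra R G) : Set G :=
  {g | conj g x = x}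

/-- The sum of all the *distinct* `G`-conjugates of `x ∈ RG`. -/
def sumConj {R G : Type*} [CommRing R] [Group G] [Fintype G] (x : MonoidAlgebra R G) :
    MonoidAlgebra R G :=
  ∑ y ∈ Finset.univ.image (fun g : G => conj g x), y

/-- A primitive central idempotent of a ring: a nonzero central idempotent that is not the sum of
two nonzero orthogonal central idempotents. -/
structure IsPrimitiveCentralIdempotent {A : Type*} [Ring A] (e : A) : Prop where
  idem : IsIdempotentElem e
  central : e ∈ Subring.center A
  ne_zero : e ≠ 0
  primitive : ∀ a b : A, IsIdempotentElem a → a ∈ Subring.center A →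
    IsIdempotentElem b → b ∈ Subring.center A → a * b = 0 → a + b = e → a = 0 ∨ b = 0

/-! ### (Strong) Shoda pairs -/

section Rational

variable {G : Type*} [Group G] [Fintype G]

/-- `L̂ = |L|⁻¹ ∑_{x ∈ L} x` in the rational group algebra. -/
def hat (L : Subgroup G) : MonoidAlgebra ℚ G :=
  ∑ x : L, MonoidAlgebra.single (x : G) ((Nat.card L : ℚ)⁻¹)

/-- `L / K` is a minimal non-trivial normal subgroup of `H / K`. -/
def IsMinimalOver (H K L : Subgroup G) : Prop :=
  Minimal (fun M : Subgroup G => K < M ∧ M ≤ H ∧ (M.subgroupOf H).Normal) L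

theorem single_mul_hat {L : Subgroup G} {x : G} (hx : x ∈ L) :
    MonoidAlgebra.single x (1 : ℚ) * hat L = hat L := by
  unfold hat
  rw [Finset.mul_sum]
  refine Fintype.sum_equiv (Equiv.mulLeft (⟨x, hx⟩ : L)) _ _ fun y => ?_
  simp [MonoidAlgebra.single_mul_single]

theorem hat_mul_single {L : Subgroup G} {x : G} (hx : x ∈ L) :
    hat L * MonoidAlgebra.single x (1 : ℚ) = hat L := by
  unfold hat
  rw [Finset.sum_mul]
  refine Fintype.sum_equiv (Equiv.mulRight (⟨x, hx⟩ : L)) _ _ fun y => ?_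
  simp [MonoidAlgebra.single_mul_single]

theorem hat_eq_smul (L : Subgroup G) :
    hat L = (Nat.card L : ℚ)⁻¹ • ∑ x : L, MonoidAlgebra.single (x : G) (1 : ℚ) := by
  simp [hat, Finset.smul_sum]

theorem hat_mul_hat_of_le {K L : Subgroup G} (h : K ≤ L) :
    hat K * hat L = hat L ∧ hat L * hat K = hat L := by
  have hc : (Nat.card K : ℚ) ≠ 0 := by exact_mod_cast Nat.card_pos.ne'
  constructor
  · rw [hat_eq_smul K, smul_mul_assoc, Finset.sum_mul,
      Finset.sum_congr rfl fun x _ => single_mul_hat (h x.2)]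
    rw [Finset.sum_const, Finset.card_univ, ← Nat.card_eq_fintype_card,
      ← Nat.cast_smul_eq_nsmul ℚ, smul_smul, inv_mul_cancel₀ hc, one_smul]
  · rw [hat_eq_smul K, mul_smul_comm, Finset.mul_sum,
      Finset.sum_congr rfl fun x _ => hat_mul_single (h x.2)]
    rw [Finset.sum_const, Finset.card_univ, ← Nat.card_eq_fintype_card,
      ← Nat.cast_smul_eq_nsmul ℚ, smul_smul, inv_mul_cancel₀ hc, one_smul]

theorem single_commute_hat {H L : Subgroup G} (hLH : L ≤ H) (hn : (L.subgroupOf H).Normal)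
    {x : G} (hx : x ∈ H) : Commute (MonoidAlgebra.single x (1 : ℚ)) (hat L) := by
  have key : ∀ y ∈ H, ∀ l ∈ L, y * l * y⁻¹ ∈ L := fun y hy l hl =>
    hn.conj_mem ⟨l, hLH hl⟩ hl ⟨y, hy⟩
  unfold Commute SemiconjBy hat
  rw [Finset.mul_sum, Finset.sum_mul]
  let e : L ≃ L :=
    { toFun := fun l => ⟨x * l * x⁻¹, key x hx l l.2⟩
      invFun := fun l => ⟨x⁻¹ * l * x, by simpa using key x⁻¹ (inv_mem hx) l l.2⟩
      left_inv := fun l => by ext; simp [mul_assoc]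
      right_inv := fun l => by ext; simp [mul_assoc] }
  refine Fintype.sum_equiv e _ _ fun y => ?_
  simp [e, MonoidAlgebra.single_mul_single]

theorem hat_commute_hat {H L L' : Subgroup G} (hLH : L ≤ H) (hn : (L.subgroupOf H).Normal)
    (hL' : L' ≤ H) : Commute (hat L') (hat L) := by
  rw [hat_eq_smul L']
  exact (Commute.sum_left _ _ _ fun x _ => single_commute_hat hLH hn (hL' x.2)).smul_left _

/-- The factors of `ε(H, K)` commute, so that their product needs no ordering. -/
theorem eps_factors_commute (H K : Subgroup G) :
    ((Finset.univ.filter (IsMinimalOver H K) : Finset (Subgroup G)) : Set (Subgroup G)).Pairwise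
      (Function.onFun Commute fun L => hat K - hat L) := by
  intro L hL L' hL' _
  simp only [Finset.coe_filter, Finset.mem_univ, true_and, Set.mem_ofPred_eq] at hL hL'
  have h1 := hat_mul_hat_of_le hL.prop.1.le
  have h2 := hat_mul_hat_of_le hL'.prop.1.le
  have h3 : Commute (hat L) (hat L') := hat_commute_hat hL'.prop.2.1 hL'.prop.2.2 hL.prop.2.1
  have h4 : Commute (hat K) (hat L) := h1.1.trans h1.2.symm
  have h5 : Commute (hat K) (hat L') := h2.1.trans h2.2.symm
  exact ((Commute.refl _).sub_right h5).sub_left (h4.symm.sub_right h3)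

/-- `ε(H, K) ∈ ℚG`: it is `K̂` if `H = K`, and otherwise the product of all `K̂ - L̂`, where `L / K`
runs over the minimal non-trivial normal subgroups of `H / K`. -/
def eps (H K : Subgroup G) : MonoidAlgebra ℚ G :=
  if H = K then hat K
  else (Finset.univ.filter (IsMinimalOver H K)).noncommProd (fun L => hat K - hat L)
    (eps_factors_commute H K)

/-- `(H, K)` is a Shoda pair of `G`; that `K` is normal in `H` is carried by the instance. -/
structure IsShodaPair (H K : Subgroup G) [(K.subgroupOf H).Normal] : Prop where
  le : K ≤ H
  cyclic : IsCyclic (H ⧸ K.subgroupOf H)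
  /-- If `[H, g] ∩ H ⊆ K`, then `g ∈ H`. -/
  mem_of_commutators : ∀ g : G, {x | ∃ h ∈ H, x = h⁻¹ * g⁻¹ * h * g} ∩ (H : Set G) ⊆ K → g ∈ H

/-- `(H, K)` is a strong Shoda pair of `G`. -/
structure IsStrongShodaPair (H K : Subgroup G) [(K.subgroupOf H).Normal] : Prop
    extends IsShodaPair H K where
  le_normalizer : H ≤ Subgroup.normalizer (K : Set G)
  normal_normalizer : (H.subgroupOf (Subgroup.normalizer (K : Set G))).Normal
  /-- `H / K` is a maximal abelian subgroup of `N_G(K) / K`. -/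
  maximal_abelian :
    Maximal (fun B : Subgroup (Subgroup.normalizer (K : Set G) ⧸
        K.subgroupOf (Subgroup.normalizer (K : Set G))) => IsMulCommutative B)
      ((H.subgroupOf (Subgroup.normalizer (K : Set G))).map
        (QuotientGroup.mk' (K.subgroupOf (Subgroup.normalizer (K : Set G)))))
  orthogonal : ∀ g : G, g ∉ Subgroup.normalizer (K : Set G) →
    eps H K * conj g (eps H K) = 0

end Rational

/-! ### Cyclotomic classes of characters and the idempotents in characteristic `p` -/

/-- The field `𝔽_p(ξ_k)` inside the algebraic closure of `𝔽_p`, generated by the `k`-th roots of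
unity (equivalently, by a primitive one, if `p ∤ k`). -/
def cycField (p k : ℕ) [Fact p.Prime] :
    IntermediateField (ZMod p) (AlgebraicClosure (ZMod p)) :=
  IntermediateField.adjoin (ZMod p) {x | x ^ k = 1}

section Characters

variable {G : Type*} [Group G] (p : ℕ) [Fact p.Prime]
  (H K : Subgroup G) [(K.subgroupOf H).Normal]

/-- `Irr(H/K)`: the irreducible characters over the algebraic closure of `𝔽_p` of the abelian group
`H/K`, that is, the group of its linear characters. -/
abbrev LinChar : Type _ := (H ⧸ K.subgroupOf H) →* (AlgebraicClosure (ZMod p))ˣ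

variable {p H K}

theorem linChar_mem_cycField [Finite G] (χ : LinChar p H K) (x : H ⧸ K.subgroupOf H) :
    (χ x : AlgebraicClosure (ZMod p)) ∈ cycField p (Nat.card (H ⧸ K.subgroupOf H)) := by
  apply IntermediateField.subset_adjoin
  show (χ x : AlgebraicClosure (ZMod p)) ^ _ = 1
  rw [← Units.val_pow_eq_pow_val, ← map_pow, pow_card_eq_one', map_one, Units.val_one]

/-- The value `χ(x)`, as an element of `𝔽_p(ξ_k)` with `k = [H : K]`. -/
def LinChar.val [Finite G] (χ : LinChar p H K) (x : H ⧸ K.subgroupOf H) :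
    cycField p (Nat.card (H ⧸ K.subgroupOf H)) :=
  ⟨χ x, linChar_mem_cycField χ x⟩

/-- The `p`-cyclotomic class of `χ`: its orbit under `Gal(𝔽_p(ξ_k)/𝔽_p)`, which acts on characters
by composition. -/
def cyclotomicClass [Finite G] (χ : LinChar p H K) : Set (LinChar p H K) :=
  {ψ | ∃ σ : cycField p (Nat.card (H ⧸ K.subgroupOf H)) ≃ₐ[ZMod p]
      cycField p (Nat.card (H ⧸ K.subgroupOf H)),
    ∀ x, LinChar.val ψ x = σ (LinChar.val χ x)}

variable (p H K) in
/-- `𝒞_p(H/K)`: the `p`-cyclotomic classes that contain generators of `Irr(H/K)`. -/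
def genClasses [Finite G] : Set (Set (LinChar p H K)) :=
  {C | (∃ χ, C = cyclotomicClass χ) ∧ ∃ ψ ∈ C, Subgroup.zpowers ψ = ⊤}

/-- The element `|H|⁻¹ ∑_{h ∈ H} tr(χ(hK)) h⁻¹` of `𝔽_p G` (supported on `H`), where `tr` is the
trace of `𝔽_p(ξ_k)/𝔽_p`. -/
def epsChar [Fintype G] (χ : LinChar p H K) : MonoidAlgebra (ZMod p) G :=
  (Nat.card H : ZMod p)⁻¹ • ∑ h : H, MonoidAlgebra.single (h : G)⁻¹
    (Algebra.trace (ZMod p) (cycField p (Nat.card (H ⧸ K.subgroupOf H)))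
      (LinChar.val χ (QuotientGroup.mk h)))

/-- `ε_C(H, K)`, computed from any `χ ∈ C`; see `epsClass_eq` for the independence of `χ`. -/
def epsClass [Fintype G] (C : Set (LinChar p H K)) : MonoidAlgebra (ZMod p) G :=
  if hC : C.Nonempty then epsChar hC.some else 0

theorem epsChar_eq [Fintype G] {χ ψ : LinChar p H K} (h : ψ ∈ cyclotomicClass χ) :
    epsChar ψ = epsChar χ := by
  obtain ⟨σ, hσ⟩ := h
  unfold epsChar
  congr 1
  refine Finset.sum_congr rfl fun x _ => ?_
  rw [hσ, Algebra.trace_eq_of_algEquiv]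

theorem epsClass_eq [Fintype G] {C : Set (LinChar p H K)} (hC : C ∈ genClasses p H K)
    {χ : LinChar p H K} (hχ : χ ∈ C) : epsClass C = epsChar χ := by
  obtain ⟨⟨θ, rfl⟩, -⟩ := hC
  have hne : (cyclotomicClass θ).Nonempty := ⟨χ, hχ⟩
  rw [epsClass, dif_pos hne, epsChar_eq hne.some_mem, epsChar_eq hχ]

/-- The class `C ^ g`, for `g ∈ N_G(K)`, under the natural action of `N_G(K)` on characters,
`χ ^ g (hK) = χ(g h g⁻¹ K)`. -/
def conjClass (g : G) (C : Set (LinChar p H K)) : Set (LinChar p H K) :=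
  {ψ | ∃ χ ∈ C, ∀ h h' : H, (h' : G) = g * h * g⁻¹ →
    ψ (QuotientGroup.mk h) = χ (QuotientGroup.mk h')}

/-- `e_C(G, H, K)`: the sum of the distinct `G`-conjugates of `ε_C(H, K)`. -/
def eClass [Fintype G] (C : Set (LinChar p H K)) : MonoidAlgebra (ZMod p) G :=
  sumConj (epsClass C)

end Characters

/-! ### Lifting to `ℤ/p^r` -/

section Lift

variable {G : Type*} [Group G] [Fintype G]

/-- An element of `𝔽_p G`, regarded as an element of `ℤ_{p^r} G` by taking each coefficient to be
one of `0, 1, …, p - 1`. -/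
def digitLift {p : ℕ} (r : ℕ) (x : MonoidAlgebra (ZMod p) G) :
    MonoidAlgebra (ZMod (p ^ r)) G :=
  ∑ g : G, MonoidAlgebra.single g ((x.coeff g).val : ZMod (p ^ r))

/-- Coefficientwise reduction modulo `p`. -/
def reduce {p r : ℕ} (hr : 1 ≤ r) (x : MonoidAlgebra (ZMod (p ^ r)) G) :
    MonoidAlgebra (ZMod p) G :=
  MonoidAlgebra.mapRingHom G
    (ZMod.castHom (dvd_pow_self p (Nat.one_le_iff_ne_zero.mp hr)) (ZMod p)) x

/-- `(∑_{k=1}^n (-1)^{k-1} binom(n,k) a^k)^n`, where `n` is the nilpotency index of `a - a²`: the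
idempotent that lifts the class of `a` modulo a nil ideal containing `a - a²`. -/
def idemLift {A : Type*} [Ring A] (a : A) : A :=
  (∑ k ∈ Finset.Icc 1 (nilpotencyClass (a - a ^ 2)),
    (-1) ^ (k - 1) * (((nilpotencyClass (a - a ^ 2)).choose k : ℕ) : A) * a ^ k) ^
      nilpotencyClass (a - a ^ 2)

variable {p : ℕ} [Fact p.Prime] {H K : Subgroup G} [(K.subgroupOf H).Normal]

/-- `ω_C(H, K) ∈ ℤ_{p^r} G` (supported on `H`). -/
def omegaClass (r : ℕ) (C : Set (LinChar p H K)) : MonoidAlgebra (ZMod (p ^ r)) G :=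
  idemLift (digitLift r (epsClass C))

/-- `w_C(G, H, K)`: the sum of the distinct `G`-conjugates of `ω_C(H, K)`. -/
def wClass (r : ℕ) (C : Set (LinChar p H K)) : MonoidAlgebra (ZMod (p ^ r)) G :=
  sumConj (omegaClass r C)

end Lift

end ShodaLift

end

/-! Everything is proved over `𝔽_p` first and then carried along the nil ideal `p·ℤ_{p^r}G`.

Over `F = 𝔽_p(ξ_k)`, `ε_C` splits as the sum of the idempotents `e_φ` of the Galois conjugates `φ`
of a faithful `χ ∈ C` (`baseExt_epsChar`). These are pairwise orthogonal, because the values of `χ`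
are all the `k`-th roots of unity and so the conjugates of `χ` are distinct. Shoda's condition says
that conjugation by any `g ∉ H` moves `χ` visibly, which forces `e_χ x e_χ ∈ F e_χ` for every `x`.
Hence an idempotent commuting with `H` either kills or fixes `e_χ`; if it has coefficients in `𝔽_p`,
Galois invariance gives the same for `ε_C` (`mul_epsChar_eq_zero_or`). This dichotomy yields the
primitivity, and also shows that a conjugate of `ε_C` by an element of `N_G(K)` is equal or
orthogonal to `ε_{C'}`.

For `g ∉ N_G(K)` the orthogonality comes from the rational hypothesis on `ε(H,K)`. A multiple of
`ε(H,K)` by an integer whose prime factors divide `|G|` has integral coefficients; that integer is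
invertible modulo `p^r`, so `ε(H,K)` has an image `E` in `ℤ_{p^r}G` with `E E^g = 0`, and `E` lies
above every `ω_C` (`exists_idempotent_above`).

The lift to `ℤ_{p^r}` rests on two facts. An idempotent that vanishes modulo `p` is zero
(`eq_zero_of_reduceHom_eq_zero`), so orthogonality and absorption can be tested modulo `p`. And
`ω_C` is obtained from `ε_C` by a construction that commutes with conjugation, so the conjugates of
`ω_C` coincide exactly when those of `ε_C` do (`conj_omegaChar_eq_iff`). -/

namespace ShodaLift

/-! ### Conjugation in group rings. -/

section Conj

variable {R S G : Type*} [CommRing R] [CommRing S] [Group G]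

/-- Conjugation by `g`, as an endomorphism of the group ring. -/
noncomputable def conjHom (g : G) : MonoidAlgebra R G →+* MonoidAlgebra R G where
  toFun := conj g
  map_one' := by simp [conj, MonoidAlgebra.single_mul_single, MonoidAlgebra.one_def]
  map_mul' x y := by
    have h : (MonoidAlgebra.single g (1 : R)) * MonoidAlgebra.single g⁻¹ 1 = 1 := by
      simp [MonoidAlgebra.single_mul_single, MonoidAlgebra.one_def]
    calc conj g (x * y)
        = MonoidAlgebra.single g⁻¹ 1 * x * 1 * y * MonoidAlgebra.single g 1 := by
          simp [conj, mul_assoc]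
      _ = conj g x * conj g y := by rw [← h]; simp only [conj, mul_assoc]
  map_zero' := by simp [conj]
  map_add' x y := by simp [conj, mul_add, add_mul]

theorem conjHom_apply (g : G) (x : MonoidAlgebra R G) : conjHom g x = conj g x := rfl

@[simp] theorem coeff_conj (g : G) (x : MonoidAlgebra R G) (h : G) :
    (conj g x).coeff h = x.coeff (g * h * g⁻¹) := by
  simp [conj, MonoidAlgebra.coeff_mul_single_apply, MonoidAlgebra.coeff_single_mul_apply, mul_assoc]

theorem conj_conj (g h : G) (x : MonoidAlgebra R G) : conj h (conj g x) = conj (g * h) x := by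
  ext y
  simp [mul_assoc]

@[simp] theorem conj_one (x : MonoidAlgebra R G) : conj 1 x = x := by
  ext y
  simp

theorem conj_conj_inv (g : G) (x : MonoidAlgebra R G) : conj g (conj g⁻¹ x) = x := by
  simp [conj_conj]

theorem conj_inv_conj (g : G) (x : MonoidAlgebra R G) : conj g⁻¹ (conj g x) = x := by
  simp [conj_conj]

theorem conj_injective (g : G) : Function.Injective (conj g : MonoidAlgebra R G → _) :=
  Function.LeftInverse.injective (conj_inv_conj g)

theorem conj_mul (g : G) (x y : MonoidAlgebra R G) : conj g (x * y) = conj g x * conj g y :=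
  map_mul (conjHom g) x y

@[simp] theorem conj_zero (g : G) : conj g (0 : MonoidAlgebra R G) = 0 := map_zero (conjHom g)

theorem conj_single (g h : G) (c : R) :
    conj g (MonoidAlgebra.single h c) = MonoidAlgebra.single (g⁻¹ * h * g) c := by
  simp [conj, MonoidAlgebra.single_mul_single]

theorem conj_sum {ι : Type*} (g : G) (s : Finset ι) (f : ι → MonoidAlgebra R G) :
    conj g (∑ i ∈ s, f i) = ∑ i ∈ s, conj g (f i) :=
  map_sum (conjHom g) f s

theorem conj_smul (g : G) (c : R) (x : MonoidAlgebra R G) : conj g (c • x) = c • conj g x := by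
  simp [conj]

theorem mul_conj (g : G) (x : MonoidAlgebra R G) :
    MonoidAlgebra.single g 1 * conj g x = x * MonoidAlgebra.single g 1 := by
  have h : (MonoidAlgebra.single g (1 : R)) * MonoidAlgebra.single g⁻¹ 1 = 1 := by
    simp [MonoidAlgebra.single_mul_single, MonoidAlgebra.one_def]
  rw [conj, ← mul_assoc, ← mul_assoc, h, one_mul]

theorem conj_eq_iff_commute (g : G) (x : MonoidAlgebra R G) :
    conj g x = x ↔ Commute (MonoidAlgebra.single g 1) x := by
  constructor
  · intro h
    have := mul_conj g x
    rwa [h] at this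
  · intro h
    have h' : (MonoidAlgebra.single g⁻¹ (1 : R)) * MonoidAlgebra.single g 1 = 1 := by
      simp [MonoidAlgebra.single_mul_single, MonoidAlgebra.one_def]
    rw [conj, mul_assoc, ← h.eq, ← mul_assoc, h', one_mul]

theorem mem_center_iff_conj (x : MonoidAlgebra R G) :
    x ∈ Subring.center (MonoidAlgebra R G) ↔ ∀ g, conj g x = x := by
  rw [Subring.mem_center_iff]
  constructor
  · exact fun h g => (conj_eq_iff_commute g x).2 (h _)
  · intro h y
    induction y using MonoidAlgebra.induction_on with
    | of g => exact (conj_eq_iff_commute g x).1 (h g)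
    | add a b ha hb => rw [add_mul, mul_add, ha, hb]
    | smul r a ha => rw [smul_mul_assoc, mul_smul_comm, ha]

theorem map_conj (f : R →+* S) (g : G) (x : MonoidAlgebra R G) :
    MonoidAlgebra.mapRingHom G f (conj g x) = conj g (MonoidAlgebra.mapRingHom G f x) := by
  ext y
  simp

theorem mapRingHom_injective {f : R →+* S} (hf : Function.Injective f) :
    Function.Injective (MonoidAlgebra.mapRingHom G f) := by
  intro x y h
  ext g
  apply hf
  rw [← MonoidAlgebra.coeff_mapRingHom, h, MonoidAlgebra.coeff_mapRingHom]

end Conj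

/-! ### Sums of distinct conjugates of an idempotent. -/

section SumConj

variable {R S G : Type*} [CommRing R] [CommRing S] [Group G] [Fintype G]

theorem conj_sumConj (g : G) (x : MonoidAlgebra R G) : conj g (sumConj x) = sumConj x := by
  rw [sumConj, conj_sum]
  refine Finset.sum_bij (fun y _ => conj g y) ?_ (fun _ _ _ _ h => conj_injective g h) ?_
    fun _ _ => rfl
  · simp only [Finset.mem_image, Finset.mem_univ, true_and]
    rintro _ ⟨h, rfl⟩
    exact ⟨h * g, (conj_conj h g x).symm⟩
  · simp only [Finset.mem_image, Finset.mem_univ, true_and]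
    rintro _ ⟨h, rfl⟩
    exact ⟨conj (h * g⁻¹) x, ⟨_, rfl⟩, by simp [conj_conj]⟩

theorem sumConj_conj (g : G) (x : MonoidAlgebra R G) : sumConj (conj g x) = sumConj x := by
  unfold sumConj
  congr 1
  ext y
  simp only [Finset.mem_image, Finset.mem_univ, true_and, conj_conj]
  exact ⟨fun ⟨h, e⟩ => ⟨_, e⟩, fun ⟨h, e⟩ => ⟨g⁻¹ * h, by rwa [mul_inv_cancel_left]⟩⟩

/-- The sums run over distinct conjugates, so `hinj` is needed: conjugates of `x` that merge under
`f` would be counted several times. -/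
theorem map_sumConj (f : R →+* S) (x : MonoidAlgebra R G) (y : MonoidAlgebra S G)
    (hxy : MonoidAlgebra.mapRingHom G f x = y)
    (hinj : ∀ g h : G, conj g y = conj h y → conj g x = conj h x) :
    MonoidAlgebra.mapRingHom G f (sumConj x) = sumConj y := by
  rw [sumConj, map_sum]
  refine Finset.sum_bij (fun z _ => MonoidAlgebra.mapRingHom G f z) ?_ ?_ ?_ fun _ _ => rfl
  · simp only [Finset.mem_image, Finset.mem_univ, true_and]
    rintro _ ⟨h, rfl⟩
    exact ⟨h, by rw [map_conj, hxy]⟩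
  · simp only [Finset.mem_image, Finset.mem_univ, true_and]
    rintro _ ⟨g, rfl⟩ _ ⟨h, rfl⟩ e
    rw [map_conj, map_conj, hxy] at e
    exact hinj g h e
  · simp only [Finset.mem_image, Finset.mem_univ, true_and]
    rintro _ ⟨h, rfl⟩
    exact ⟨conj h x, ⟨h, rfl⟩, by rw [map_conj, hxy]⟩

/-- By orthogonality only the summand `e` itself survives. -/
theorem mul_sumConj {e : MonoidAlgebra R G} (he : IsIdempotentElem e)
    (horth : ∀ g, e * conj g e = 0 ∨ e = conj g e) : e * sumConj e = e := by
  rw [sumConj, Finset.mul_sum, Finset.sum_eq_single e]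
  · exact he
  · simp only [Finset.mem_image, Finset.mem_univ, true_and]
    rintro _ ⟨g, rfl⟩ hne
    exact (horth g).resolve_right (Ne.symm hne)
  · intro h
    exact absurd (Finset.mem_image_of_mem (fun g : G => conj g e) (Finset.mem_univ 1))
      (by simpa only [conj_one] using h)

theorem mul_sumConj_eq_zero {a e : MonoidAlgebra R G} (h : ∀ g, a * conj g e = 0) :
    a * sumConj e = 0 := by
  rw [sumConj, Finset.mul_sum]
  refine Finset.sum_eq_zero fun y hy => ?_
  obtain ⟨g, -, rfl⟩ := Finset.mem_image.1 hy
  exact h g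

theorem isIdempotentElem_sumConj {e : MonoidAlgebra R G} (he : IsIdempotentElem e)
    (horth : ∀ g, e * conj g e = 0 ∨ e = conj g e) : IsIdempotentElem (sumConj e) := by
  show sumConj e * sumConj e = sumConj e
  conv_lhs => rw [sumConj]
  rw [Finset.sum_mul, ← sumConj, sumConj]
  refine Finset.sum_congr rfl fun y hy => ?_
  obtain ⟨g, -, rfl⟩ := Finset.mem_image.1 hy
  rw [← sumConj]
  nth_rewrite 1 [← conj_sumConj g]
  rw [← conj_mul, mul_sumConj he horth]

/-- The sum of the conjugates of `e` is a primitive central idempotent if the conjugates are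
pairwise orthogonal and no central idempotent splits `e`. -/
theorem isPrimitiveCentralIdempotent_sumConj {e : MonoidAlgebra R G} (he : IsIdempotentElem e)
    (hne : e ≠ 0) (horth : ∀ g, e * conj g e = 0 ∨ e = conj g e)
    (hsplit : ∀ f ∈ Subring.center (MonoidAlgebra R G), IsIdempotentElem f →
      f * e = 0 ∨ f * e = e) :
    IsPrimitiveCentralIdempotent (sumConj e) where
  idem := isIdempotentElem_sumConj he horth
  central := (mem_center_iff_conj _).2 fun g => conj_sumConj g e
  ne_zero h := hne (by rw [← mul_sumConj he horth, h, mul_zero])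
  primitive a b ha hac hb hbc hab hsum := by
    -- A central element that kills `e` kills every conjugate of `e`. Since `a` and `b` are
    -- orthogonal, `a * sumConj e = a` and `b * sumConj e = b`, so killing `e` means being zero.
    have key : ∀ c ∈ Subring.center (MonoidAlgebra R G), c * e = 0 → c * sumConj e = 0 := by
      intro c hc h
      refine mul_sumConj_eq_zero fun g => ?_
      rw [← (mem_center_iff_conj c).1 hc g, ← conj_mul, h, conj_zero]
    have hba : b * a = 0 := by rw [Subring.mem_center_iff.1 hac b, hab]
    rcases hsplit a hac ha with h | h
    · left
      have := key a hac h
      rwa [← hsum, mul_add, ha.eq, hab, add_zero] at this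
    · right
      have h0 : b * e = 0 := by rw [← h, ← mul_assoc, hba, zero_mul]
      have := key b hbc h0
      rwa [← hsum, mul_add, hb.eq, hba, zero_add] at this

/-- If `e'` were orthogonal to all conjugates of `e`, then `e' = e' * sumConj e' = e' * sumConj e =
0`. -/
theorem exists_mul_conj_ne_zero_of_sumConj_eq {e e' : MonoidAlgebra R G} (he' : IsIdempotentElem e')
    (hne' : e' ≠ 0) (horth' : ∀ g, e' * conj g e' = 0 ∨ e' = conj g e')
    (h : sumConj e = sumConj e') : ∃ g, e' * conj g e ≠ 0 := by
  by_contra! hall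
  apply hne'
  rw [← mul_sumConj he' horth', ← h, mul_sumConj_eq_zero hall]

theorem sumConj_mul_sumConj_eq_zero {e e' : MonoidAlgebra R G}
    (h : ∀ g, e' * conj g e = 0 ∨ e' = conj g e) (hne : sumConj e ≠ sumConj e') :
    sumConj e * sumConj e' = 0 := by
  have hc : sumConj e * sumConj e' = sumConj e' * sumConj e :=
    (Subring.mem_center_iff.1 ((mem_center_iff_conj _).2 fun g => conj_sumConj g e) _).symm
  have h0 : e' * sumConj e = 0 := mul_sumConj_eq_zero fun g => (h g).resolve_right fun heq =>
    hne (by rw [heq, sumConj_conj])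
  have : sumConj e * e' = 0 := by
    rw [← h0]
    exact (Subring.mem_center_iff.1 ((mem_center_iff_conj _).2 fun g => conj_sumConj g e) _).symm
  refine mul_sumConj_eq_zero fun g => ?_
  rw [← conj_sumConj g, ← conj_mul, this, conj_zero]

end SumConj

/-! ### Lifting idempotents by an explicit polynomial. -/

section IdemLift

variable {A B : Type*} [Ring A] [Ring B]

/-- By the binomial theorem the alternating sum is `1 - (1 - a) ^ n`; this closed form is the one
used from here on. -/
theorem idemLift_eq (a : A) :
    idemLift a = (1 - (1 - a) ^ nilpotencyClass (a - a ^ 2)) ^ nilpotencyClass (a - a ^ 2) := by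
  unfold idemLift
  congr 1
  generalize nilpotencyClass (a - a ^ 2) = n
  have h : (1 - a) ^ n = ∑ k ∈ Finset.range (n + 1), (-a) ^ k * ((n.choose k : ℕ) : A) := by
    rw [sub_eq_neg_add, (Commute.one_right (-a)).add_pow]
    simp
  rw [h, Finset.sum_range_succ', pow_zero, Nat.choose_zero_right, Nat.cast_one, one_mul,
    sub_add_cancel_right, ← Finset.sum_neg_distrib, ← Finset.Ico_add_one_right_eq_Icc,
    Finset.sum_Ico_eq_sum_range]
  refine Finset.sum_congr rfl fun k _ => ?_
  rw [add_comm 1 k, Nat.add_sub_cancel, neg_pow a, pow_succ (-1 : A) k, mul_assoc, mul_assoc,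
    (Nat.cast_commute _ (a ^ (k + 1))).eq]
  simp

theorem isIdempotentElem_idemLift {a : A} (ha : IsNilpotent (a - a ^ 2)) :
    IsIdempotentElem (idemLift a) := by
  rw [idemLift_eq]
  set n := nilpotencyClass (a - a ^ 2) with hn
  have h0 : (a - a ^ 2) ^ n = 0 := pow_nilpotencyClass ha
  have h1 : ((1 - a) - (1 - a) ^ 2) ^ n = 0 := by
    rw [← h0]
    congr 1
    noncomm_ring
  -- The general result makes `1 - (1 - x ^ n) ^ n` idempotent when `(x - x²) ^ n = 0`. The lift is
  -- its complement for `x = 1 - a`, and `x - x² = a - a²`.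
  have := (isIdempotentElem_one_sub_one_sub_pow_pow (1 - a) n h1).one_sub
  rwa [sub_sub_cancel] at this

theorem nilpotencyClass_map {f : A →+* B} (hf : Function.Injective f) (x : A) :
    nilpotencyClass (f x) = nilpotencyClass x := by
  unfold nilpotencyClass
  congr 1
  ext k
  simp only [Set.mem_ofPred_eq]
  rw [← map_pow, map_eq_zero_iff f hf]

/-- The exponent `n` depends on the ring element; injectivity keeps it the same on both sides. -/
theorem map_idemLift {f : A →+* B} (hf : Function.Injective f) (a : A) :
    f (idemLift a) = idemLift (f a) := by
  rw [idemLift_eq, idemLift_eq, ← map_pow f a, ← map_sub, nilpotencyClass_map hf]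
  simp

/-- An idempotent which is nilpotent vanishes. -/
theorem eq_zero_of_isIdempotentElem_of_isNilpotent {x : A} (h : IsIdempotentElem x)
    (hx : IsNilpotent x) : x = 0 := by
  obtain ⟨n, hn⟩ := hx
  rw [← h.pow_succ_eq n, pow_succ, hn, zero_mul]

/-- Positive powers of the idempotents `f a` and `1 - f a` collapse, so the polynomial fixes `f a`
as soon as `n ≥ 1`. -/
theorem idemLift_image {f : A →+* B} {a : A} (ha : IsNilpotent (a - a ^ 2)) (hA : Nontrivial A)
    (he : IsIdempotentElem (f a)) : f (idemLift a) = f a := by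
  rw [idemLift_eq]
  set n := nilpotencyClass (a - a ^ 2) with hn
  -- Nilpotency index `0` would mean `1 = 0`.
  have h0 : n ≠ 0 := by
    intro h
    have := pow_nilpotencyClass ha
    rw [← hn, h, pow_zero] at this
    exact one_ne_zero this
  simp only [map_pow, map_sub, map_one]
  obtain ⟨m, hm⟩ := Nat.exists_eq_succ_of_ne_zero h0
  rw [hm]
  rw [he.one_sub.pow_succ_eq, sub_sub_cancel, he.pow_succ_eq]

end IdemLift

/-! ### Integral multiples of the rational idempotent. -/

section IntegralMultiple

variable {G : Type*} [Group G] [Fintype G]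

/-- The sum of the elements of `L`, in the group ring over `R`. -/
noncomputable def subgroupSum (R : Type*) [CommRing R] (L : Subgroup G) : MonoidAlgebra R G :=
  ∑ x : L, MonoidAlgebra.single (x : G) 1

theorem map_subgroupSum {R S : Type*} [CommRing R] [CommRing S] (f : R →+* S) (L : Subgroup G) :
    MonoidAlgebra.mapRingHom G f (subgroupSum R L) = subgroupSum S L := by
  simp [subgroupSum]

theorem subgroupSum_rat (L : Subgroup G) : subgroupSum ℚ L = (Nat.card L : ℚ) • hat L := by
  rw [hat_eq_smul, smul_smul, mul_inv_cancel₀ (by exact_mod_cast Nat.card_pos.ne'), one_smul,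
    subgroupSum]

theorem mul_subgroupSum {R : Type*} [CommRing R] {L : Subgroup G} {e : MonoidAlgebra R G}
    (h : ∀ x ∈ L, e * MonoidAlgebra.single x 1 = e) : e * subgroupSum R L = Nat.card L • e := by
  rw [subgroupSum, Finset.mul_sum, Finset.sum_congr rfl fun (x : L) _ => h x x.2, Finset.sum_const,
    Finset.card_univ, Nat.card_eq_fintype_card]

/-- An element `y` of the rational group algebra has an integral multiple `P` by a factor that is
invertible wherever `|G|` is; `P` lies in the span of `H`, and acts as that factor on whatever is
fixed by `K` and killed by the sums over the larger subgroups of `H`. -/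
def HasIntegralMultiple (H K : Subgroup G) (y : MonoidAlgebra ℚ G) : Prop :=
  ∃ (P : MonoidAlgebra ℤ G) (c : ℕ),
    (∀ q : ℕ, q.Prime → q ∣ c → q ∣ Fintype.card G) ∧
    MonoidAlgebra.mapRingHom G (Int.castRingHom ℚ) P = c • y ∧
    (∀ (R : Type) [CommRing R] (x : MonoidAlgebra R G),
      (∀ h ∈ H, Commute (MonoidAlgebra.single h 1) x) →
        Commute (MonoidAlgebra.mapRingHom G (Int.castRingHom R) P) x) ∧
    (∀ (R : Type) [CommRing R] (e : MonoidAlgebra R G),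
      (∀ k ∈ K, e * MonoidAlgebra.single k 1 = e) →
      (∀ L : Subgroup G, K < L → L ≤ H → e * subgroupSum R L = 0) →
        e * MonoidAlgebra.mapRingHom G (Int.castRingHom R) P = c • e)

variable {H K : Subgroup G}

theorem prime_dvd_card_of_dvd_card_subgroup (L : Subgroup G) {q : ℕ} (h : q ∣ Nat.card L) :
    q ∣ Fintype.card G :=
  h.trans (Nat.card_eq_fintype_card (α := G) ▸ L.card_subgroup_dvd_card)

theorem commute_subgroupSum {R : Type*} [CommRing R] {x : MonoidAlgebra R G}
    (hx : ∀ h ∈ H, Commute (MonoidAlgebra.single h 1) x) {L : Subgroup G} (hL : L ≤ H) :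
    Commute (subgroupSum R L) x :=
  Commute.sum_left _ _ _ fun y _ => hx y (hL y.2)

theorem HasIntegralMultiple.one : HasIntegralMultiple H K 1 :=
  ⟨1, 1, fun q hq h => absurd (Nat.dvd_one.1 h) hq.one_lt.ne', by simp,
    fun R _ x _ => by simp, fun R _ e _ _ => by simp⟩

theorem HasIntegralMultiple.mul {y z : MonoidAlgebra ℚ G} (hy : HasIntegralMultiple H K y)
    (hz : HasIntegralMultiple H K z) : HasIntegralMultiple H K (y * z) := by
  obtain ⟨P, c, hc, hP, hcomm, hact⟩ := hy
  obtain ⟨Q, d, hd, hQ, hcomm', hact'⟩ := hz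
  refine ⟨P * Q, c * d, fun q hq h => ?_, ?_, fun R _ x hx => ?_, fun R _ e hK hL => ?_⟩
  · exact (hq.dvd_mul.1 h).elim (hc q hq) (hd q hq)
  · rw [map_mul, hP, hQ, smul_mul_assoc, mul_smul_comm, smul_smul]
  · rw [map_mul]
    exact (hcomm R x hx).mul_left (hcomm' R x hx)
  · rw [map_mul, ← mul_assoc, hact R e hK hL, smul_mul_assoc, hact' R e hK hL, smul_smul]

theorem HasIntegralMultiple.hat (hK : K ≤ H) : HasIntegralMultiple H K (hat K) := by
  refine ⟨subgroupSum ℤ K, Nat.card K,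
    fun q _ h => prime_dvd_card_of_dvd_card_subgroup K h, ?_, fun R _ x hx => ?_,
    fun R _ e he _ => ?_⟩
  · rw [map_subgroupSum, subgroupSum_rat, Nat.cast_smul_eq_nsmul]
  · rw [map_subgroupSum]
    exact commute_subgroupSum hx hK
  · rw [map_subgroupSum, mul_subgroupSum he]

/-- Multiplying by `|L||K|` clears both denominators. On an `e` fixed by `K` the first sum then
contributes the whole factor, and the second is among those killed by `e`. -/
theorem HasIntegralMultiple.hat_sub_hat {L : Subgroup G} (hK : K < L) (hL : L ≤ H) :
    HasIntegralMultiple H K (ShodaLift.hat K - ShodaLift.hat L) := by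
  refine ⟨Nat.card L • subgroupSum ℤ K - Nat.card K • subgroupSum ℤ L, Nat.card L * Nat.card K,
    fun q hq h => ?_, ?_, fun R _ x hx => ?_, fun R _ e he he' => ?_⟩
  · exact (hq.dvd_mul.1 h).elim (prime_dvd_card_of_dvd_card_subgroup L)
      (prime_dvd_card_of_dvd_card_subgroup K)
  · rw [map_sub, map_nsmul, map_nsmul, map_subgroupSum, map_subgroupSum, subgroupSum_rat,
      subgroupSum_rat, Nat.cast_smul_eq_nsmul, Nat.cast_smul_eq_nsmul, smul_smul, smul_smul,
      mul_comm (Nat.card K), ← smul_sub]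
  · rw [map_sub, map_nsmul, map_nsmul, map_subgroupSum, map_subgroupSum]
    exact ((commute_subgroupSum hx (hK.le.trans hL)).smul_left _).sub_left
      ((commute_subgroupSum hx hL).smul_left _)
  · rw [map_sub, map_nsmul, map_nsmul, map_subgroupSum, map_subgroupSum, mul_sub, mul_smul_comm,
      mul_smul_comm, he' L hK hL, smul_zero, sub_zero, mul_subgroupSum he, smul_smul]

/-- The property is multiplicative, so it passes from the factors to the product. -/
theorem hasIntegralMultiple_eps (hK : K ≤ H) : HasIntegralMultiple H K (eps H K) := by
  unfold eps
  split_ifs with h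
  · exact HasIntegralMultiple.hat hK
  · refine Finset.noncommProd_induction _ _ _ _ (fun _ _ => HasIntegralMultiple.mul)
      HasIntegralMultiple.one fun L hL => ?_
    have hL' := (Finset.mem_filter.1 hL).2
    exact HasIntegralMultiple.hat_sub_hat hL'.prop.1 hL'.prop.2.1

/-- Each `K̂ - L̂` is idempotent because `K̂` absorbs into `L̂`, and the factors commute. -/
theorem isIdempotentElem_eps : IsIdempotentElem (eps H K) := by
  unfold eps
  split_ifs with h
  · exact (hat_mul_hat_of_le le_rfl).1
  · have hf : ∀ L ∈ Finset.univ.filter (IsMinimalOver H K),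
        (hat K - hat L) * (hat K - hat L) = hat K - hat L := by
      intro L hL
      have h1 := hat_mul_hat_of_le (Finset.mem_filter.1 hL).2.prop.1.le
      rw [mul_sub, sub_mul, sub_mul, (hat_mul_hat_of_le (le_refl K)).1, h1.1, h1.2,
        (hat_mul_hat_of_le (le_refl L)).1]
      abel
    have := Finset.noncommProd_mul_distrib (fun L => hat K - hat L) (fun L => hat K - hat L)
      (eps_factors_commute H K) (eps_factors_commute H K) (eps_factors_commute H K)
    refine this.symm.trans (Finset.noncommProd_congr rfl hf _)

/-- An integral multiple of `ε(H, K)`. -/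
theorem exists_integral_eps [(K.subgroupOf H).Normal] (hHK : IsStrongShodaPair H K) :
    ∃ (P : MonoidAlgebra ℤ G) (c : ℕ),
      (∀ q : ℕ, q.Prime → q ∣ c → q ∣ Fintype.card G) ∧
      P * P = c • P ∧
      (∀ g, g ∉ Subgroup.normalizer (K : Set G) → P * conj g P = 0) ∧
      (∀ (R : Type) [CommRing R] (x : MonoidAlgebra R G),
        (∀ h ∈ H, Commute (MonoidAlgebra.single h 1) x) →
          Commute (MonoidAlgebra.mapRingHom G (Int.castRingHom R) P) x) ∧
      (∀ (R : Type) [CommRing R] (e : MonoidAlgebra R G),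
        (∀ k ∈ K, e * MonoidAlgebra.single k 1 = e) →
        (∀ L : Subgroup G, K < L → L ≤ H → e * subgroupSum R L = 0) →
          e * MonoidAlgebra.mapRingHom G (Int.castRingHom R) P = c • e) := by
  obtain ⟨P, c, hc, hP, hcomm, hact⟩ := hasIntegralMultiple_eps hHK.le
  -- Identities between integral elements are verified in `ℚG`, where `P` becomes `c • eps H K`.
  have hinj : Function.Injective (MonoidAlgebra.mapRingHom G (Int.castRingHom ℚ)) :=
    mapRingHom_injective Int.cast_injective
  refine ⟨P, c, hc, hinj ?_, fun g hg => hinj ?_, hcomm, hact⟩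
  · rw [map_mul, map_nsmul, hP, smul_mul_assoc, mul_smul_comm, isIdempotentElem_eps.eq]
  · rw [map_mul, map_conj, hP, map_zero, smul_mul_assoc, ← conjHom_apply, map_nsmul,
      mul_smul_comm, conjHom_apply, hHK.orthogonal g hg, smul_zero, smul_zero]

end IntegralMultiple

/-! ### Idempotents of linear characters over a field. -/

section CharacterIdempotents

theorem single_eq_smul {L G : Type*} [Field L] (g : G) (c : L) :
    MonoidAlgebra.single g c = c • MonoidAlgebra.single g (1 : L) := by
  simp

variable {L G : Type*} [Field L] [Group G] [Fintype G] {H : Subgroup G}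

/-- The idempotent `|H|⁻¹ ∑_{h ∈ H} φ(h) h⁻¹` of a linear character `φ` of `H`. -/
noncomputable def charIdem (φ : H →* L) : MonoidAlgebra L G :=
  (Nat.card H : L)⁻¹ • ∑ h : H, MonoidAlgebra.single (h : G)⁻¹ (φ h)

theorem single_mul_charIdem (φ : H →* L) (h : H) :
    MonoidAlgebra.single (h : G) 1 * charIdem φ = φ h • charIdem φ := by
  rw [charIdem, mul_smul_comm, smul_comm (φ h), Finset.mul_sum, Finset.smul_sum (r := φ h)]
  congr 1
  apply Fintype.sum_equiv (Equiv.mulRight h⁻¹)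
  intro x
  have hx : φ x = φ h * φ (x * h⁻¹) := by rw [mul_comm, ← map_mul, inv_mul_cancel_right]
  rw [hx]
  simp [MonoidAlgebra.single_mul_single, -map_mul]

theorem charIdem_mul_single (φ : H →* L) (h : H) :
    charIdem φ * MonoidAlgebra.single (h : G) 1 = φ h • charIdem φ := by
  rw [charIdem, smul_mul_assoc, smul_comm (φ h), Finset.sum_mul,
    Finset.smul_sum (r := φ h)]
  congr 1
  apply Fintype.sum_equiv (Equiv.mulLeft h⁻¹)
  intro x
  have hx : φ x = φ h * φ (h⁻¹ * x) := by rw [← map_mul, mul_inv_cancel_left]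
  rw [hx]
  simp [MonoidAlgebra.single_mul_single, -map_mul]

/-- On a `φ`-eigenvector each of the `|H|` terms `φ(h) h⁻¹` acts as the identity, and the average is
taken. -/
theorem charIdem_mul_of_single_mul {φ : H →* L} (hL : (Nat.card H : L) ≠ 0)
    {x : MonoidAlgebra L G} (hx : ∀ h : H, MonoidAlgebra.single (h : G) 1 * x = φ h • x) :
    charIdem φ * x = x := by
  rw [charIdem, smul_mul_assoc, Finset.sum_mul]
  have : ∀ h : H, MonoidAlgebra.single (h : G)⁻¹ (φ h) * x = x := by
    intro h
    have h1 := hx h⁻¹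
    rw [Subgroup.coe_inv] at h1
    rw [single_eq_smul, smul_mul_assoc, h1, smul_smul,
      ← map_mul, mul_inv_cancel, map_one, one_smul]
  rw [Finset.sum_congr rfl fun h _ => this h, Finset.sum_const, Finset.card_univ,
    ← Nat.card_eq_fintype_card, ← Nat.cast_smul_eq_nsmul L, smul_smul, inv_mul_cancel₀ hL, one_smul]

theorem isIdempotentElem_charIdem (hL : (Nat.card H : L) ≠ 0) (φ : H →* L) :
    IsIdempotentElem (charIdem φ) :=
  charIdem_mul_of_single_mul hL (single_mul_charIdem φ)

theorem charIdem_ne_zero (hL : (Nat.card H : L) ≠ 0) (φ : H →* L) : charIdem φ ≠ 0 := by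
  intro h
  have h1 := congrArg (fun x => x.coeff 1) h
  simp only [charIdem, MonoidAlgebra.coeff_smul_apply, MonoidAlgebra.coeff_sum,
    Finsupp.finsetSum_apply, MonoidAlgebra.coeff_zero, Finsupp.zero_apply] at h1
  rw [Finset.sum_eq_single 1] at h1
  · simp only [inv_one, OneMemClass.coe_one, map_one, MonoidAlgebra.coeff_single,
      Finsupp.single_eq_same, smul_eq_mul, mul_one] at h1
    exact inv_ne_zero hL h1
  · intro b _ hb
    rw [MonoidAlgebra.coeff_single, Finsupp.single_apply, if_neg]
    simpa using hb
  · simp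

/-- Inserting `h` to the left of `x`, or equivalently `h'` to its right, scales the same product by
`φ h` and by `ψ h'`; as these differ, it is zero. -/
theorem charIdem_mul_mul_charIdem {φ ψ : H →* L} {x : MonoidAlgebra L G} {h h' : H}
    (hx : MonoidAlgebra.single (h : G) 1 * x = x * MonoidAlgebra.single (h' : G) 1)
    (hne : φ h ≠ ψ h') : charIdem φ * x * charIdem ψ = 0 := by
  have h1 : charIdem φ * (MonoidAlgebra.single (h : G) 1 * x) * charIdem ψ
      = φ h • (charIdem φ * x * charIdem ψ) := by
    rw [← mul_assoc, charIdem_mul_single, smul_mul_assoc, smul_mul_assoc]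
  have h2 : charIdem φ * (MonoidAlgebra.single (h : G) 1 * x) * charIdem ψ
      = ψ h' • (charIdem φ * x * charIdem ψ) := by
    rw [hx, ← mul_assoc, mul_assoc, single_mul_charIdem, mul_smul_comm]
  have h3 : (φ h - ψ h') • (charIdem φ * x * charIdem ψ) = 0 := by
    rw [sub_smul, ← h1, ← h2, sub_self]
  exact (smul_eq_zero.1 h3).resolve_left (sub_ne_zero.2 hne)

theorem charIdem_mul_charIdem {φ ψ : H →* L} (hne : φ ≠ ψ) : charIdem φ * charIdem ψ = 0 := by
  obtain ⟨h, hh⟩ := DFunLike.ne_iff.1 hne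
  have := charIdem_mul_mul_charIdem (x := 1) (h := h) (h' := h) (by simp) hh
  rwa [mul_one] at this

/-- Shoda's condition on a character `φ` of `H` makes `e x e` a multiple of `e`, for `e` its
idempotent. -/
theorem exists_charIdem_mul_mul_charIdem {φ : H →* L} (hL : (Nat.card H : L) ≠ 0)
    (hφ : ∀ g : G, g ∉ H → ∃ h h' : H, (h' : G) = g⁻¹ * h * g ∧ φ h ≠ φ h')
    (x : MonoidAlgebra L G) : ∃ c : L, charIdem φ * x * charIdem φ = c • charIdem φ := by
  induction x using MonoidAlgebra.induction_on with
  | of g =>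
    by_cases hg : g ∈ H
    · refine ⟨φ ⟨g, hg⟩, ?_⟩
      have := charIdem_mul_single φ ⟨g, hg⟩
      rw [MonoidAlgebra.of_apply, this, smul_mul_assoc, (isIdempotentElem_charIdem hL φ).eq]
    · obtain ⟨h, h', e, hne⟩ := hφ g hg
      refine ⟨0, ?_⟩
      rw [zero_smul]
      refine charIdem_mul_mul_charIdem (h := h) (h' := h') ?_ hne
      simp [MonoidAlgebra.single_mul_single, e, mul_assoc]
  | add a b ha hb =>
    obtain ⟨c, hc⟩ := ha
    obtain ⟨d, hd⟩ := hb
    exact ⟨c + d, by rw [mul_add, add_mul, hc, hd, add_smul]⟩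
  | smul r a ha =>
    obtain ⟨c, hc⟩ := ha
    exact ⟨r * c, by rw [mul_smul_comm, smul_mul_assoc, hc, smul_smul]⟩

/-- Write `e` for the idempotent of `φ`. As `f` commutes with `e`, `f e = e f e = c e`, and
idempotency of `f` gives `c² = c` in a field. -/
theorem mul_charIdem_eq_zero_or {φ : H →* L} (hL : (Nat.card H : L) ≠ 0)
    (hφ : ∀ g : G, g ∉ H → ∃ h h' : H, (h' : G) = g⁻¹ * h * g ∧ φ h ≠ φ h')
    {f : MonoidAlgebra L G} (hf : IsIdempotentElem f)
    (hcomm : ∀ h ∈ H, Commute (MonoidAlgebra.single h 1) f) :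
    f * charIdem φ = 0 ∨ f * charIdem φ = charIdem φ := by
  have hc : Commute f (charIdem φ) := by
    refine Commute.smul_right (Commute.sum_right _ _ _ fun h _ => ?_) _
    rw [single_eq_smul]
    exact ((hcomm _ (H.inv_mem h.2)).symm).smul_right _
  obtain ⟨c, hc'⟩ := exists_charIdem_mul_mul_charIdem hL hφ f
  have h1 : f * charIdem φ = c • charIdem φ := by
    rw [← hc', ← hc.eq, mul_assoc, (isIdempotentElem_charIdem hL φ).eq]
  have h2 : (c * c - c) • charIdem φ = 0 := by
    rw [sub_smul, mul_smul, ← h1, ← mul_smul_comm, ← h1, ← mul_assoc, hf.eq, sub_self]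
  have h3 := (smul_eq_zero.1 h2).resolve_right (charIdem_ne_zero hL φ)
  have h4 : c * (c - 1) = 0 := by rw [← h3]; ring
  rcases mul_eq_zero.1 h4 with h | h
  · left; rw [h1, h, zero_smul]
  · right; rw [h1, sub_eq_zero.1 h, one_smul]

theorem map_charIdem {M : Type*} [Field M] (σ : L →+* M) (φ : H →* L) :
    MonoidAlgebra.mapRingHom G σ (charIdem φ) = charIdem ((σ : L →* M).comp φ) := by
  ext g
  simp [charIdem, MonoidAlgebra.coeff_sum, Finsupp.single_apply,
    apply_ite σ]

theorem conj_sum_single {R : Type*} [CommRing R] {u v : H → R} {g : G}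
    (hg : ∀ x : G, x ∈ H ↔ g⁻¹ * x * g ∈ H)
    (h : ∀ x y : H, (y : G) = g * x * g⁻¹ → v x = u y) :
    conj g (∑ x : H, MonoidAlgebra.single (x : G)⁻¹ (u x)) =
      ∑ x : H, MonoidAlgebra.single (x : G)⁻¹ (v x) := by
  rw [conj_sum]
  refine Fintype.sum_equiv
    { toFun := fun x : H => (⟨g⁻¹ * x * g, (hg x).1 x.2⟩ : H)
      invFun := fun x : H => ⟨g * x * g⁻¹, (hg _).2 (by simp [mul_assoc])⟩
      left_inv := fun x => by ext; simp [mul_assoc]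
      right_inv := fun x => by ext; simp [mul_assoc] } _ _ fun x => ?_
  rw [conj_single, Equiv.coe_fn_mk, h _ x (by simp [mul_assoc])]
  congr 1
  simp [mul_assoc]

theorem conj_charIdem {φ ψ : H →* L} {g : G} (hg : ∀ x : G, x ∈ H ↔ g⁻¹ * x * g ∈ H)
    (h : ∀ x y : H, (y : G) = g * x * g⁻¹ → ψ x = φ y) : conj g (charIdem φ) = charIdem ψ := by
  rw [charIdem, charIdem, conj_smul, conj_sum_single hg h]

end CharacterIdempotents

/-! ### Faithful characters and the Galois action. -/

section Characters

theorem natCast_card_subgroup_ne_zero {G : Type*} [Group G] [Fintype G] {p : ℕ} {R : Type*} [Ring R] [Nontrivial R] [CharP R p]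
    (hpG : ¬ p ∣ Fintype.card G) (L : Subgroup G) : (Nat.card L : R) ≠ 0 := by
  rw [Ne, CharP.cast_eq_zero_iff R p]
  exact fun h => hpG (prime_dvd_card_of_dvd_card_subgroup L h)

theorem not_dvd_card_quotient {G : Type*} [Group G] [Fintype G] {p : ℕ} {H K : Subgroup G}
    (hpG : ¬ p ∣ Fintype.card G) :
    ¬ p ∣ Nat.card (H ⧸ K.subgroupOf H) := fun h =>
  hpG (prime_dvd_card_of_dvd_card_subgroup H (h.trans (K.subgroupOf H).card_quotient_dvd_card))

variable {G : Type*} [Group G] [Fintype G] {p : ℕ} [Fact p.Prime]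
  {H K : Subgroup G} [(K.subgroupOf H).Normal]

/-- The field generated by the roots of unity of a positive order is finite over `𝔽_p`. -/
theorem finiteDimensional_cycField (k : ℕ) (hk : k ≠ 0) :
    FiniteDimensional (ZMod p) (cycField p k) := by
  have : Finite {x : AlgebraicClosure (ZMod p) | x ^ k = 1} := by
    refine Set.Finite.to_subtype (Set.Finite.subset
      (Polynomial.nthRoots k (1 : AlgebraicClosure (ZMod p))).toFinset.finite_toSet fun x hx => ?_)
    simpa [Polynomial.mem_nthRoots (Nat.pos_of_ne_zero hk)] using hx
  exact IntermediateField.finiteDimensional_adjoin fun x _ => Algebra.IsIntegral.isIntegral x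

instance finiteDimensional_cycField_card :
    FiniteDimensional (ZMod p) (cycField p (Nat.card (H ⧸ K.subgroupOf H))) :=
  finiteDimensional_cycField _ Nat.card_pos.ne'

instance finite_cycField_card : Finite (cycField p (Nat.card (H ⧸ K.subgroupOf H))) :=
  Module.finite_of_finite (ZMod p)

/-- A linear character of `H / K`, as a character of `H` with values in `𝔽_p(ξ_k)`. -/
noncomputable def charHom (χ : LinChar p H K) :
    H →* cycField p (Nat.card (H ⧸ K.subgroupOf H)) where
  toFun x := LinChar.val χ (QuotientGroup.mk x)
  map_one' := by
    apply Subtype.ext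
    simp [LinChar.val]
  map_mul' x y := by
    apply Subtype.ext
    simp [LinChar.val]

/-- The image of a character under the Galois group. -/
noncomputable def galHom (χ : LinChar p H K)
    (σ : cycField p (Nat.card (H ⧸ K.subgroupOf H)) ≃ₐ[ZMod p]
      cycField p (Nat.card (H ⧸ K.subgroupOf H))) :
    H →* cycField p (Nat.card (H ⧸ K.subgroupOf H)) :=
  ((σ : cycField p (Nat.card (H ⧸ K.subgroupOf H)) →+*
    cycField p (Nat.card (H ⧸ K.subgroupOf H))) : _ →* _).comp (charHom χ)

theorem charHom_apply (χ : LinChar p H K) (x : H) :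
    charHom χ x = LinChar.val χ (QuotientGroup.mk x) := rfl

theorem galHom_apply (χ : LinChar p H K)
    (σ : cycField p (Nat.card (H ⧸ K.subgroupOf H)) ≃ₐ[ZMod p]
      cycField p (Nat.card (H ⧸ K.subgroupOf H))) (x : H) :
    galHom χ σ x = σ (LinChar.val χ (QuotientGroup.mk x)) := rfl

theorem mem_cyclotomicClass_iff {χ ψ : LinChar p H K} :
    ψ ∈ cyclotomicClass χ ↔ ∃ σ, charHom ψ = galHom χ σ := by
  refine exists_congr fun σ => ⟨fun h => MonoidHom.ext fun x => h _, fun h x => ?_⟩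
  obtain ⟨x, rfl⟩ := QuotientGroup.mk_surjective x
  exact DFunLike.congr_fun h x

theorem self_mem_cyclotomicClass (χ : LinChar p H K) : χ ∈ cyclotomicClass χ :=
  ⟨AlgEquiv.refl, fun _ => rfl⟩

theorem cyclotomicClass_eq {χ ψ : LinChar p H K} (h : ψ ∈ cyclotomicClass χ) :
    cyclotomicClass ψ = cyclotomicClass χ := by
  obtain ⟨σ, hσ⟩ := h
  ext θ
  constructor
  · rintro ⟨τ, hτ⟩
    exact ⟨σ.trans τ, fun x => by rw [hτ, hσ]; rfl⟩
  · rintro ⟨τ, hτ⟩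
    exact ⟨σ.symm.trans τ, fun x => by rw [hτ, hσ]; simp⟩

/-- A generator of the character group is faithful. -/
theorem mk_eq_one_of_generator (hpG : ¬ p ∣ Fintype.card G) (hcyc : IsCyclic (H ⧸ K.subgroupOf H))
    {χ : LinChar p H K} (hχ : Subgroup.zpowers χ = ⊤) {x : H ⧸ K.subgroupOf H} (hx : χ x = 1) :
    x = 1 := by
  by_contra hne
  let _ : CommGroup (H ⧸ K.subgroupOf H) := IsCyclic.commGroup
  -- Since `p` does not divide the order, there are enough roots of unity for characters to separate
  -- points: some `φ` is nontrivial at `x`. But `φ` is a power of `χ`.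
  have : NeZero ((Monoid.exponent (H ⧸ K.subgroupOf H) : ℕ) : AlgebraicClosure (ZMod p)) := by
    constructor
    rw [Ne, CharP.cast_eq_zero_iff _ p, IsCyclic.exponent_eq_card]
    exact not_dvd_card_quotient hpG
  obtain ⟨φ, hφ⟩ := CommGroup.exists_apply_ne_one_of_hasEnoughRootsOfUnity
    (H ⧸ K.subgroupOf H) (AlgebraicClosure (ZMod p)) hne
  obtain ⟨n, hn⟩ := Subgroup.mem_zpowers_iff.1 (hχ ▸ Subgroup.mem_top φ : φ ∈ Subgroup.zpowers χ)
  apply hφ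
  have h := DFunLike.congr_fun hn x
  rw [← h]
  show χ x ^ n = 1
  rw [hx, one_zpow]

/-- `χ` is injective on `H / K`. -/
def IsFaithful (χ : LinChar p H K) : Prop := ∀ x, χ x = 1 → x = 1

theorem IsFaithful.mem {χ : LinChar p H K} (hχ : IsFaithful χ) {σ} {x : H}
    (h : galHom χ σ x = 1) : (x : G) ∈ K := by
  rw [galHom_apply, map_eq_one_iff σ σ.injective] at h
  have h1 : χ (QuotientGroup.mk x) = 1 := Units.ext (congrArg Subtype.val h)
  exact Subgroup.mem_subgroupOf.1 ((QuotientGroup.eq_one_iff x).1 (hχ _ h1))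

theorem galHom_eq_one (χ : LinChar p H K) (σ) {x : H} (h : (x : G) ∈ K) : galHom χ σ x = 1 := by
  have h1 : (QuotientGroup.mk x : H ⧸ K.subgroupOf H) = 1 :=
    (QuotientGroup.eq_one_iff x).2 (Subgroup.mem_subgroupOf.2 h)
  have h2 : LinChar.val χ (QuotientGroup.mk x) = 1 := by
    rw [h1]
    apply Subtype.ext
    simp [LinChar.val]
  rw [galHom_apply, h2, map_one]

theorem galHom_refl (χ : LinChar p H K) : galHom χ AlgEquiv.refl = charHom χ := rfl

/-- The values of a faithful character are all the roots of unity. -/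
theorem IsFaithful.exists_eq {χ : LinChar p H K} (hχ : IsFaithful χ)
    {ζ : AlgebraicClosure (ZMod p)} (hζ : ζ ^ Nat.card (H ⧸ K.subgroupOf H) = 1) :
    ∃ x, (χ x : AlgebraicClosure (ZMod p)) = ζ := by
  have : NeZero (Nat.card (H ⧸ K.subgroupOf H)) := ⟨Nat.card_pos.ne'⟩
  let f : H ⧸ K.subgroupOf H →
      rootsOfUnity (Nat.card (H ⧸ K.subgroupOf H)) (AlgebraicClosure (ZMod p)) :=
    fun x => ⟨χ x, by rw [mem_rootsOfUnity, ← map_pow, pow_card_eq_one', map_one]⟩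
  have hf : Function.Injective f := fun x y h =>
    (injective_iff_map_eq_one χ).2 hχ (congrArg Subtype.val h)
  -- There are at most `k` roots of unity of order dividing `k`, and `H / K` already has `k`
  -- elements.
  have hf' : Function.Bijective f :=
    Function.Injective.bijective_of_nat_card_le hf (card_rootsOfUnity _ _)
  obtain ⟨x, hx⟩ := hf'.2 (rootsOfUnity.mkOfPowEq ζ hζ)
  refine ⟨x, ?_⟩
  have := congrArg (fun u => ((u.1 : (AlgebraicClosure (ZMod p))ˣ) : AlgebraicClosure (ZMod p))) hx
  simpa [f] using this

/-- The values of `χ` include the roots of unity that generate the field, so `σ` is determined by `σ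
∘ χ`. -/
theorem IsFaithful.galHom_injective {χ : LinChar p H K} (hχ : IsFaithful χ) :
    Function.Injective (galHom χ) := by
  intro σ τ h
  have : (σ : cycField p (Nat.card (H ⧸ K.subgroupOf H)) →ₐ[ZMod p]
      cycField p (Nat.card (H ⧸ K.subgroupOf H))) = τ := by
    refine IntermediateField.algHom_ext_of_eq_adjoin (ZMod p) rfl fun ζ hζ => ?_
    obtain ⟨x, hx⟩ := hχ.exists_eq hζ
    obtain ⟨y, rfl⟩ := QuotientGroup.mk_surjective x
    have h1 := DFunLike.congr_fun h y
    rw [galHom_apply, galHom_apply] at h1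
    have h2 : LinChar.val χ (QuotientGroup.mk y) = ⟨ζ, IntermediateField.subset_adjoin _ _ hζ⟩ :=
      Subtype.ext hx
    rw [h2] at h1
    exact h1
  exact AlgEquiv.coe_toAlgHom_injective this

/-- Shoda's condition makes conjugation move a faithful character outside `H`. -/
theorem IsFaithful.exists_ne (hHK : IsShodaPair H K) {χ : LinChar p H K} (hχ : IsFaithful χ) {g : G}
    (hg : g ∉ H) : ∃ h h' : H, (h' : G) = g⁻¹ * h * g ∧ charHom χ h ≠ charHom χ h' := by
  have := mt (hHK.mem_of_commutators g) hg
  obtain ⟨x, ⟨⟨h, hh, rfl⟩, hxH⟩, hxK⟩ := Set.not_subset.1 this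
  -- The commutator `x = h⁻¹g⁻¹hg` lies in `H` but not in `K`, so `g⁻¹hg = h x` is in `H`. Equal
  -- values at `h` and `h x` would give `χ(x) = 1`, that is, `x ∈ K`.
  refine ⟨⟨h, hh⟩, ⟨h, hh⟩ * ⟨_, hxH⟩, by simp [mul_assoc], fun heq => hxK ?_⟩
  refine hχ.mem (σ := AlgEquiv.refl) (x := ⟨_, hxH⟩) ?_
  rw [galHom_refl]
  rw [map_mul] at heq
  have h0 : charHom χ ⟨h, hh⟩ ≠ 0 := by
    intro h0
    have h1 := map_mul (charHom χ) ⟨h, hh⟩ ⟨h, hh⟩⁻¹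
    rw [mul_inv_cancel, map_one, h0, zero_mul] at h1
    exact one_ne_zero h1
  exact (mul_eq_left₀ h0).1 heq.symm

/-- Extension of scalars from `𝔽_p` to `𝔽_p(ξ_k)`. -/
noncomputable abbrev baseExt (p : ℕ) [Fact p.Prime] (H K : Subgroup G) [(K.subgroupOf H).Normal] :
    MonoidAlgebra (ZMod p) G →+*
      MonoidAlgebra (cycField p (Nat.card (H ⧸ K.subgroupOf H))) G :=
  MonoidAlgebra.mapRingHom G (algebraMap _ _)

omit [Fintype G] in
theorem baseExt_injective : Function.Injective (baseExt p H K) :=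
  mapRingHom_injective (algebraMap (ZMod p) _).injective

/-- Over `𝔽_p(ξ_k)`, the element `ε_C` is the sum of the idempotents of the characters in `C`. -/
theorem baseExt_epsChar (χ : LinChar p H K) :
    baseExt p H K (epsChar χ) = ∑ σ, charIdem (galHom χ σ) := by
  simp only [charIdem]
  rw [← Finset.smul_sum, Finset.sum_comm]
  ext g
  simp only [epsChar, MonoidAlgebra.coeff_mapRingHom, MonoidAlgebra.coeff_smul_apply,
    MonoidAlgebra.coeff_sum, Finsupp.finsetSum_apply, MonoidAlgebra.coeff_single,
    Finsupp.single_apply, smul_eq_mul, map_mul, map_inv₀, map_natCast, map_sum, apply_ite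
      (algebraMap (ZMod p) (cycField p (Nat.card (H ⧸ K.subgroupOf H)))), map_zero,
      trace_eq_sum_automorphisms]
  congr 2
  refine congrArg _ (funext fun x => ?_)
  split_ifs
  · rfl
  · simp

end Characters

/-! ### The idempotents `ε_C` in characteristic `p`. -/

section ModP

variable {G : Type*} [Group G] [Fintype G] {p : ℕ} [Fact p.Prime]
  {H K : Subgroup G} [(K.subgroupOf H).Normal]

theorem charIdem_mul_baseExt (hpG : ¬ p ∣ Fintype.card G) {χ : LinChar p H K} (hχ : IsFaithful χ)
    (σ) : charIdem (galHom χ σ) * baseExt p H K (epsChar χ) = charIdem (galHom χ σ) := by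
  rw [baseExt_epsChar, Finset.mul_sum, Finset.sum_eq_single σ]
  · exact isIdempotentElem_charIdem (natCast_card_subgroup_ne_zero (p := p) hpG H) _
  · exact fun τ _ h => charIdem_mul_charIdem fun e => h (hχ.galHom_injective e).symm
  · exact fun h => absurd (Finset.mem_univ σ) h

theorem isIdempotentElem_epsChar (hpG : ¬ p ∣ Fintype.card G) {χ : LinChar p H K}
    (hχ : IsFaithful χ) : IsIdempotentElem (epsChar χ) := by
  apply baseExt_injective (H := H) (K := K)
  rw [map_mul]
  conv_lhs => rw [baseExt_epsChar, Finset.sum_mul, ← baseExt_epsChar]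
  rw [Finset.sum_congr rfl fun σ _ => charIdem_mul_baseExt hpG hχ σ, baseExt_epsChar]

theorem epsChar_ne_zero (hpG : ¬ p ∣ Fintype.card G) {χ : LinChar p H K}
    (hχ : IsFaithful χ) : epsChar χ ≠ 0 := by
  intro h
  have := charIdem_mul_baseExt hpG hχ AlgEquiv.refl
  rw [h, map_zero, mul_zero] at this
  exact charIdem_ne_zero (natCast_card_subgroup_ne_zero (p := p) hpG H) _ this.symm

theorem coeff_epsChar_of_notMem (χ : LinChar p H K) {g : G} (hg : g ∉ H) :
    (epsChar χ).coeff g = 0 := by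
  simp only [epsChar, MonoidAlgebra.coeff_smul_apply, MonoidAlgebra.coeff_sum,
    Finsupp.finsetSum_apply, MonoidAlgebra.coeff_single]
  rw [Finset.sum_eq_zero, smul_zero]
  intro x _
  rw [Finsupp.single_apply, if_neg]
  rintro rfl
  exact hg (H.inv_mem x.2)

theorem commute_single_epsChar (χ : LinChar p H K) {h : G} (hh : h ∈ H) :
    Commute (MonoidAlgebra.single h 1) (epsChar χ) := by
  apply baseExt_injective (H := H) (K := K)
  rw [map_mul, map_mul, baseExt_epsChar, MonoidAlgebra.mapRingHom_single, map_one, Finset.mul_sum,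
    Finset.sum_mul]
  refine Finset.sum_congr rfl fun σ _ => ?_
  exact (single_mul_charIdem (galHom χ σ) ⟨h, hh⟩).trans
    (charIdem_mul_single (galHom χ σ) ⟨h, hh⟩).symm

theorem conj_epsChar_of_mem (χ : LinChar p H K) {h : G} (hh : h ∈ H) :
    conj h (epsChar χ) = epsChar χ :=
  (conj_eq_iff_commute _ _).2 (commute_single_epsChar χ hh)

omit [Fintype G] in
-- The vanishing of coefficients places `x` in `RH`, the span of elements commuting with `y`.
theorem commute_of_coeff_eq_zero {R : Type*} [CommRing R] {x y : MonoidAlgebra R G}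
    (hx : ∀ g, g ∉ H → x.coeff g = 0)
    (hy : ∀ h ∈ H, Commute (MonoidAlgebra.single h 1) y) : Commute x y := by
  rw [← MonoidAlgebra.sum_coeff_single x]
  refine Commute.sum_left _ _ _ fun g hg => ?_
  have hgH : g ∈ H := by
    by_contra hn
    exact Finsupp.mem_support_iff.1 hg (hx g hn)
  have : MonoidAlgebra.single g (x.coeff g) = x.coeff g • MonoidAlgebra.single g (1 : R) := by simp
  rw [this]
  exact (hy g hgH).smul_left _

theorem epsChar_mul_single (χ : LinChar p H K) (hK : K ≤ H) {k : G} (hk : k ∈ K) :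
    epsChar χ * MonoidAlgebra.single k 1 = epsChar χ := by
  apply baseExt_injective (H := H) (K := K)
  rw [map_mul, baseExt_epsChar, MonoidAlgebra.mapRingHom_single, map_one, Finset.sum_mul]
  refine Finset.sum_congr rfl fun σ _ => ?_
  have := charIdem_mul_single (galHom χ σ) ⟨k, hK hk⟩
  rwa [galHom_eq_one χ σ hk, one_smul] at this

theorem single_mul_subgroupSum {R : Type*} [CommRing R] {L : Subgroup G} {x : G} (hx : x ∈ L) :
    MonoidAlgebra.single x 1 * subgroupSum R L = subgroupSum R L := by
  unfold subgroupSum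
  rw [Finset.mul_sum]
  refine Fintype.sum_equiv (Equiv.mulLeft (⟨x, hx⟩ : L)) _ _ fun y => ?_
  simp [MonoidAlgebra.single_mul_single]

/-- An element of `L` outside `K` acts on each character idempotent by a scalar other than `1`, yet
is absorbed by the sum over `L`. -/
theorem epsChar_mul_subgroupSum {χ : LinChar p H K} (hχ : IsFaithful χ) {L : Subgroup G}
    (hK : K < L) (hL : L ≤ H) : epsChar χ * subgroupSum (ZMod p) L = 0 := by
  apply baseExt_injective (H := H) (K := K)
  rw [map_mul, baseExt_epsChar, map_subgroupSum, map_zero, Finset.sum_mul]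
  refine Finset.sum_eq_zero fun σ _ => ?_
  obtain ⟨y, hyL, hyK⟩ := SetLike.exists_of_lt hK
  have h1 := charIdem_mul_single (galHom χ σ) ⟨y, hL hyL⟩
  have h2 : charIdem (galHom χ σ) * subgroupSum _ L =
      galHom χ σ ⟨y, hL hyL⟩ • (charIdem (galHom χ σ) * subgroupSum _ L) := by
    rw [← smul_mul_assoc, ← h1, mul_assoc, single_mul_subgroupSum hyL]
  have h3 : (galHom χ σ ⟨y, hL hyL⟩ - 1) • (charIdem (galHom χ σ) * subgroupSum _ L) = 0 := by
    rw [sub_smul, ← h2, one_smul, sub_self]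
  exact (smul_eq_zero.1 h3).resolve_left (sub_ne_zero.2 fun h => hyK (hχ.mem h))

/-- An idempotent that commutes with `H` does not split `ε_C`. -/
theorem mul_epsChar_eq_zero_or (hpG : ¬ p ∣ Fintype.card G) (hHK : IsShodaPair H K)
    {χ : LinChar p H K} (hχ : IsFaithful χ) {f : MonoidAlgebra (ZMod p) G}
    (hf : IsIdempotentElem f) (hcomm : ∀ h ∈ H, Commute (MonoidAlgebra.single h 1) f) :
    f * epsChar χ = 0 ∨ f * epsChar χ = epsChar χ := by
  -- The coefficients of `f` lie in `𝔽_p`, so `f` is Galois invariant, and what `f` does to the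
  -- idempotent of `χ` it does to those of all conjugates of `χ`.
  have hf' : ∀ σ : cycField p (Nat.card (H ⧸ K.subgroupOf H)) ≃ₐ[ZMod p]
      cycField p (Nat.card (H ⧸ K.subgroupOf H)),
      MonoidAlgebra.mapRingHom G (σ : cycField p (Nat.card (H ⧸ K.subgroupOf H)) →+* _)
        (baseExt p H K f) = baseExt p H K f := by
    intro σ
    ext g
    simp
  have hσ : ∀ σ : cycField p (Nat.card (H ⧸ K.subgroupOf H)) ≃ₐ[ZMod p]
      cycField p (Nat.card (H ⧸ K.subgroupOf H)), MonoidAlgebra.mapRingHom G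
      (σ : cycField p (Nat.card (H ⧸ K.subgroupOf H)) →+* _) (charIdem (charHom χ)) =
        charIdem (galHom χ σ) := by
    intro σ
    rw [map_charIdem]
    rfl
  have key := mul_charIdem_eq_zero_or (natCast_card_subgroup_ne_zero (p := p) hpG H)
    (φ := charHom χ) (fun g hg => hχ.exists_ne hHK hg) (f := baseExt p H K f) (hf.map _)
    fun h hh => by
      have := (hcomm h hh).map (baseExt p H K)
      rwa [MonoidAlgebra.mapRingHom_single, map_one] at this
  rcases key with h | h
  · left
    apply baseExt_injective (H := H) (K := K)
    rw [map_mul, baseExt_epsChar, Finset.mul_sum, map_zero]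
    refine Finset.sum_eq_zero fun σ _ => ?_
    rw [← hσ, ← hf' σ, ← map_mul, h, map_zero]
  · right
    apply baseExt_injective (H := H) (K := K)
    rw [map_mul, baseExt_epsChar, Finset.mul_sum]
    refine Finset.sum_congr rfl fun σ _ => ?_
    rw [← hσ]
    nth_rewrite 1 [← hf' σ]
    rw [← map_mul, h]

omit [Fintype G] in
theorem commute_single_conj {R : Type*} [CommRing R] {x : MonoidAlgebra R G} {g : G}
    (hg : ∀ h, h ∈ H → g * h * g⁻¹ ∈ H)
    (hx : ∀ h ∈ H, Commute (MonoidAlgebra.single h 1) x) :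
    ∀ h ∈ H, Commute (MonoidAlgebra.single h 1) (conj g x) := by
  intro h hh
  rw [← conj_eq_iff_commute, conj_conj, ← inv_mul_cancel_right (g * h) g, ← conj_conj,
    (conj_eq_iff_commute _ _).2 (hx _ (hg h hh))]

/-- An element of the normalizer of `K` either moves `ε_C` to `ε_{C'}`, or to an orthogonal
idempotent. -/
theorem epsChar_mul_conj (hpG : ¬ p ∣ Fintype.card G) (hHK : IsShodaPair H K)
    {χ χ' : LinChar p H K} (hχ : IsFaithful χ) (hχ' : IsFaithful χ') {g : G}
    (hg : ∀ h, h ∈ H ↔ g * h * g⁻¹ ∈ H) :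
    epsChar χ' * conj g (epsChar χ) = 0 ∨ epsChar χ' = conj g (epsChar χ) := by
  have h1 : ∀ h ∈ H, Commute (MonoidAlgebra.single h 1) (conj g (epsChar χ)) :=
    commute_single_conj (fun h => (hg h).1) fun h hh => commute_single_epsChar χ hh
  have h2 : ∀ h ∈ H, Commute (MonoidAlgebra.single h 1) (conj g⁻¹ (epsChar χ')) :=
    commute_single_conj (fun h hh => (hg _).2 (by simpa [mul_assoc] using hh))
      fun h hh => commute_single_epsChar χ' hh
  have hc : epsChar χ' * conj g (epsChar χ) = conj g (epsChar χ) * epsChar χ' :=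
    commute_of_coeff_eq_zero (fun _ => coeff_epsChar_of_notMem χ') h1
  -- The dichotomy is used in both directions: the product of `ε_{C'}` and `ε_C^g` is `0` or
  -- `ε_{C'}`, and, after conjugating back, `0` or `ε_C^g`. If nonzero, it equals both.
  have k1 := mul_epsChar_eq_zero_or hpG hHK hχ'
    ((isIdempotentElem_epsChar hpG hχ).map (conjHom g)) h1
  have k2 := mul_epsChar_eq_zero_or hpG hHK hχ
    ((isIdempotentElem_epsChar hpG hχ').map (conjHom g⁻¹)) h2
  rw [conjHom_apply] at k1 k2
  rcases k1 with k1 | k1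
  · left; rw [hc, k1]
  rcases k2 with k2 | k2
  · left
    have := congrArg (conj g) k2
    rwa [conj_mul, conj_conj_inv, conj_zero] at this
  · right
    have := congrArg (conj g) k2
    rw [conj_mul, conj_conj_inv] at this
    rw [← k1, ← hc, this]

/-- The image of a character under the Galois group, as a character of `H / K`. -/
noncomputable def galChar (χ : LinChar p H K)
    (σ : cycField p (Nat.card (H ⧸ K.subgroupOf H)) ≃ₐ[ZMod p]
      cycField p (Nat.card (H ⧸ K.subgroupOf H))) : LinChar p H K :=
  MonoidHom.toHomUnits
    { toFun := fun x => ((σ (LinChar.val χ x) : cycField p (Nat.card (H ⧸ K.subgroupOf H))) :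
        AlgebraicClosure (ZMod p))
      map_one' := by
        have : LinChar.val χ 1 = 1 := Subtype.ext (by simp [LinChar.val])
        rw [this, map_one]
        rfl
      map_mul' := fun x y => by
        have : LinChar.val χ (x * y) = LinChar.val χ x * LinChar.val χ y :=
          Subtype.ext (by simp [LinChar.val])
        rw [this, map_mul]
        rfl }

theorem charHom_galChar (χ : LinChar p H K) (σ) : charHom (galChar χ σ) = galHom χ σ := rfl

/-- Conjugation by `g`, on the characters of a subgroup that it normalizes. -/
def conjChar {M : Type*} [Monoid M] (φ : H →* M) {g : G} (hg : ∀ h, h ∈ H ↔ g * h * g⁻¹ ∈ H) :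
    H →* M where
  toFun x := φ ⟨g * x * g⁻¹, (hg x).1 x.2⟩
  map_one' := by
    rw [← map_one φ]
    congr 1
    ext
    simp
  map_mul' x y := by
    rw [← map_mul]
    congr 1
    ext
    simp [mul_assoc]

theorem conj_epsChar_eq {χ χ' : LinChar p H K} {g : G} (hg : ∀ h, h ∈ H ↔ g * h * g⁻¹ ∈ H)
    (h : ∀ x y : H, (y : G) = g * x * g⁻¹ →
      χ' (QuotientGroup.mk x) = χ (QuotientGroup.mk y)) :
    conj g (epsChar χ) = epsChar χ' := by
  have hg' : ∀ x : G, x ∈ H ↔ g⁻¹ * x * g ∈ H := fun x => by rw [hg (g⁻¹ * x * g)]; simp [mul_assoc]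
  rw [epsChar, epsChar, conj_smul]
  refine congrArg _ (conj_sum_single hg' fun x y hxy => ?_)
  congr 1
  exact Subtype.ext (congrArg Units.val (h x y hxy))

/-- Idempotents of distinct characters are orthogonal, so that of `χ'` survives multiplication by
`ε_C^g` only if `χ'` is the `g`-conjugate of a Galois conjugate of `χ`. The Galois action commutes
with conjugation, so whole classes match. -/
theorem conjClass_eq_of_epsChar_eq (hpG : ¬ p ∣ Fintype.card G)
    {χ χ' : LinChar p H K} (hχ' : IsFaithful χ') {g : G} (hg : ∀ h, h ∈ H ↔ g * h * g⁻¹ ∈ H)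
    (h : epsChar χ' = conj g (epsChar χ)) :
    cyclotomicClass χ' = conjClass g (cyclotomicClass χ) := by
  have hg' : ∀ x : G, x ∈ H ↔ g⁻¹ * x * g ∈ H := fun x => by rw [hg (g⁻¹ * x * g)]; simp [mul_assoc]
  obtain ⟨σ, hσ⟩ : ∃ σ, charHom χ' = conjChar (galHom χ σ) hg := by
    by_contra! hall
    have h1 := charIdem_mul_baseExt hpG hχ' AlgEquiv.refl
    rw [h, map_conj, baseExt_epsChar, conj_sum, Finset.mul_sum, Finset.sum_eq_zero] at h1
    · exact charIdem_ne_zero (natCast_card_subgroup_ne_zero (p := p) hpG H) _ h1.symm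
    · intro σ _
      have h2 : conj g (charIdem (galHom χ σ)) = charIdem (conjChar (galHom χ σ) hg) :=
        conj_charIdem hg' fun x y hxy => congrArg (galHom χ σ) (Subtype.ext hxy.symm)
      rw [h2]
      exact charIdem_mul_charIdem (hall σ)
  have hσ' : ∀ x y : H, (y : G) = g * x * g⁻¹ → charHom χ' x = galHom χ σ y := fun x y hxy => by
    rw [hσ]
    exact congrArg (galHom χ σ) (Subtype.ext hxy.symm)
  ext ψ
  constructor
  · intro hψ
    obtain ⟨τ, hτ⟩ := mem_cyclotomicClass_iff.1 hψ
    refine ⟨galChar χ (σ.trans τ), mem_cyclotomicClass_iff.2 ⟨_, charHom_galChar χ _⟩, fun x y hxy => ?_⟩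
    have h1 : charHom ψ x = charHom (galChar χ (σ.trans τ)) y := by
      rw [hτ, charHom_galChar]
      exact congrArg τ (hσ' x y hxy)
    exact Units.ext (congrArg Subtype.val h1)
  · rintro ⟨θ, hθ, hψ⟩
    obtain ⟨τ, hτ⟩ := mem_cyclotomicClass_iff.1 hθ
    refine mem_cyclotomicClass_iff.2 ⟨σ.symm.trans τ, MonoidHom.ext fun x => ?_⟩
    have h1 := hψ x ⟨g * x * g⁻¹, (hg x).1 x.2⟩ rfl
    have h2 : charHom ψ x = charHom θ ⟨g * x * g⁻¹, (hg x).1 x.2⟩ :=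
      Subtype.ext (congrArg Units.val h1)
    rw [h2, hτ]
    have h3 := hσ' x ⟨g * x * g⁻¹, (hg x).1 x.2⟩ rfl
    rw [charHom_apply, galHom_apply] at h3
    rw [galHom_apply, galHom_apply, h3]
    simp

/-- A class is given as the orbit of an arbitrary `θ`; the generator it contains is faithful and has
the same orbit, so it serves as representative. -/
theorem exists_isFaithful (hpG : ¬ p ∣ Fintype.card G) (hHK : IsShodaPair H K)
    {C : Set (LinChar p H K)} (hC : C ∈ genClasses p H K) :
    ∃ χ, IsFaithful χ ∧ C = cyclotomicClass χ ∧ epsClass C = epsChar χ := by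
  obtain ⟨⟨θ, hθ⟩, χ, hχ, hgen⟩ := id hC
  refine ⟨χ, fun x hx => mk_eq_one_of_generator hpG hHK.cyclic hgen hx, ?_, epsClass_eq hC hχ⟩
  rw [hθ] at hχ ⊢
  exact (cyclotomicClass_eq hχ).symm

end ModP

/-! ### Reduction modulo `p` and lifting to `ℤ_{p^r}`. -/

section Reduction

variable {G : Type*} [Group G] [Fintype G] {p r : ℕ}

/-- Coefficientwise reduction modulo `p`, as a ring homomorphism. -/
noncomputable def reduceHom (G : Type*) [Group G] {p r : ℕ} (hr : 1 ≤ r) :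
    MonoidAlgebra (ZMod (p ^ r)) G →+* MonoidAlgebra (ZMod p) G :=
  MonoidAlgebra.mapRingHom G
    (ZMod.castHom (dvd_pow_self p (Nat.one_le_iff_ne_zero.mp hr)) (ZMod p))

omit [Fintype G] in
theorem reduceHom_conj (hr : 1 ≤ r) (g : G) (x : MonoidAlgebra (ZMod (p ^ r)) G) :
    reduceHom G hr (conj g x) = conj g (reduceHom G hr x) :=
  map_conj _ g x

omit [Group G] in
theorem coeff_digitLift (x : MonoidAlgebra (ZMod p) G) (g : G) :
    (digitLift r x).coeff g = ((x.coeff g).val : ZMod (p ^ r)) := by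
  simp [digitLift, MonoidAlgebra.coeff_sum, Finsupp.finsetSum_apply, Finsupp.single_apply]

/-- Digit lifting is not additive, but it acts coefficient by coefficient, and conjugation only
permutes the coefficients. -/
theorem conj_digitLift (g : G) (x : MonoidAlgebra (ZMod p) G) :
    conj g (digitLift r x) = digitLift r (conj g x) := by
  ext h
  simp [coeff_digitLift]

theorem conj_idemLift_digitLift (g : G) (x : MonoidAlgebra (ZMod p) G) :
    conj g (idemLift (digitLift r x)) = idemLift (digitLift r (conj g x)) := by
  rw [← conj_digitLift, ← conjHom_apply, ← conjHom_apply]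
  exact map_idemLift (f := conjHom g) (conj_injective g) _

variable [Fact p.Prime]

theorem reduceHom_digitLift (hr : 1 ≤ r) (x : MonoidAlgebra (ZMod p) G) :
    reduceHom G hr (digitLift r x) = x := by
  ext g
  rw [reduceHom, MonoidAlgebra.coeff_mapRingHom, coeff_digitLift, map_natCast,
    ZMod.natCast_val, ZMod.cast_id]

omit [Fintype G] in
-- Such an `x` is `p` times another element, so its `r`-th power has the factor `p ^ r = 0`.
theorem isNilpotent_of_reduceHom_eq_zero (hr : 1 ≤ r) {x : MonoidAlgebra (ZMod (p ^ r)) G}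
    (hx : reduceHom G hr x = 0) : IsNilpotent x := by
  have h : ∀ g, ∃ c : ZMod (p ^ r), x.coeff g = (p : ZMod (p ^ r)) * c := by
    intro g
    have h1 := congrArg (fun y => y.coeff g) hx
    simp only [reduceHom, MonoidAlgebra.coeff_mapRingHom, MonoidAlgebra.coeff_zero,
      Finsupp.zero_apply] at h1
    have h2 : NeZero (p ^ r) := ⟨pow_ne_zero _ (Fact.out : p.Prime).ne_zero⟩
    rw [← ZMod.natCast_zmod_val (x.coeff g), map_natCast, ZMod.natCast_eq_zero_iff] at h1
    obtain ⟨c, hc⟩ := h1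
    refine ⟨c, ?_⟩
    rw [← ZMod.natCast_zmod_val (x.coeff g), hc, Nat.cast_mul]
  choose c hc using h
  have hx' : x = (p : ZMod (p ^ r)) • ∑ g ∈ x.coeff.support, MonoidAlgebra.single g (c g) := by
    conv_lhs => rw [← MonoidAlgebra.sum_coeff_single x]
    rw [Finset.smul_sum]
    refine Finset.sum_congr rfl fun g _ => ?_
    rw [MonoidAlgebra.smul_single, smul_eq_mul, ← hc]
  refine ⟨r, ?_⟩
  rw [hx', smul_pow, ← Nat.cast_pow, ZMod.natCast_self, zero_smul]

omit [Fintype G] in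
-- This lets orthogonality of commuting idempotents be checked modulo `p`: their product is again
-- idempotent.
theorem eq_zero_of_reduceHom_eq_zero (hr : 1 ≤ r) {x : MonoidAlgebra (ZMod (p ^ r)) G}
    (h : IsIdempotentElem x) (hx : reduceHom G hr x = 0) : x = 0 :=
  eq_zero_of_isIdempotentElem_of_isNilpotent h (isNilpotent_of_reduceHom_eq_zero hr hx)

theorem isNilpotent_digitLift_sub (hr : 1 ≤ r) {x : MonoidAlgebra (ZMod p) G}
    (hx : IsIdempotentElem x) : IsNilpotent (digitLift r x - digitLift r x ^ 2) := by
  refine isNilpotent_of_reduceHom_eq_zero hr ?_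
  rw [map_sub, map_pow, reduceHom_digitLift, pow_two, hx.eq, sub_self]

theorem isIdempotentElem_idemLift_digitLift (hr : 1 ≤ r) {x : MonoidAlgebra (ZMod p) G}
    (hx : IsIdempotentElem x) : IsIdempotentElem (idemLift (digitLift r x)) :=
  isIdempotentElem_idemLift (isNilpotent_digitLift_sub hr hx)

theorem reduceHom_idemLift (hr : 1 ≤ r) {x : MonoidAlgebra (ZMod p) G}
    (hx : IsIdempotentElem x) : reduceHom G hr (idemLift (digitLift r x)) = x := by
  have hnt : Nontrivial (MonoidAlgebra (ZMod (p ^ r)) G) :=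
    have : Fact (1 < p ^ r) :=
      ⟨Nat.one_lt_pow (Nat.one_le_iff_ne_zero.mp hr) (Fact.out : p.Prime).one_lt⟩
    inferInstance
  have h := reduceHom_digitLift (r := r) hr x
  have := idemLift_image (f := reduceHom G hr) (isNilpotent_digitLift_sub hr hx) hnt
    (by rwa [h])
  rw [this, h]

theorem Commute.idemLift_left {A : Type*} [Ring A] {a b : A} (h : Commute a b) :
    Commute (idemLift a) b := by
  rw [idemLift_eq]
  exact (((Commute.one_left b).sub_left
    (((Commute.one_left b).sub_left h).pow_left _))).pow_left _

omit [Fintype G] in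
theorem map_intCast_eq_reduceHom (hr : 1 ≤ r) (P : MonoidAlgebra ℤ G) :
    reduceHom G hr (MonoidAlgebra.mapRingHom G (Int.castRingHom (ZMod (p ^ r))) P) =
      MonoidAlgebra.mapRingHom G (Int.castRingHom (ZMod p)) P := by
  ext g
  simp [reduceHom]

end Reduction

/-! ### The idempotents `ω_C` and their conjugates. -/

section Main

variable {G : Type*} [Group G] [Fintype G] {p r : ℕ} [Fact p.Prime]
  {H K : Subgroup G} [(K.subgroupOf H).Normal]

/-- `ω_C(H, K)` for the class of `χ`. -/
noncomputable def omegaChar (r : ℕ) (χ : LinChar p H K) : MonoidAlgebra (ZMod (p ^ r)) G :=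
  idemLift (digitLift r (epsChar χ))

theorem isIdempotentElem_omegaChar (hpG : ¬ p ∣ Fintype.card G) (hr : 1 ≤ r) {χ : LinChar p H K}
    (hχ : IsFaithful χ) : IsIdempotentElem (omegaChar r χ) :=
  isIdempotentElem_idemLift_digitLift hr (isIdempotentElem_epsChar hpG hχ)

theorem reduceHom_omegaChar (hpG : ¬ p ∣ Fintype.card G) (hr : 1 ≤ r) {χ : LinChar p H K}
    (hχ : IsFaithful χ) : reduceHom G hr (omegaChar r χ) = epsChar χ :=
  reduceHom_idemLift hr (isIdempotentElem_epsChar hpG hχ)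

theorem omegaChar_ne_zero (hpG : ¬ p ∣ Fintype.card G) (hr : 1 ≤ r) {χ : LinChar p H K}
    (hχ : IsFaithful χ) : omegaChar r χ ≠ 0 := fun h =>
  epsChar_ne_zero hpG hχ (by rw [← reduceHom_omegaChar hpG hr hχ, h, map_zero])

theorem conj_omegaChar (χ : LinChar p H K) (g : G) :
    conj g (omegaChar r χ) = idemLift (digitLift r (conj g (epsChar χ))) :=
  conj_idemLift_digitLift g _

/-- Reduction recovers the conjugate of `ε` from that of `ω`; conversely the conjugate of `ω` is the
lift of the conjugate of `ε`. -/
theorem conj_omegaChar_eq_iff (hpG : ¬ p ∣ Fintype.card G) (hr : 1 ≤ r) {χ χ' : LinChar p H K}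
    (hχ : IsFaithful χ) (hχ' : IsFaithful χ') (g h : G) :
    conj g (omegaChar r χ) = conj h (omegaChar r χ') ↔
      conj g (epsChar χ) = conj h (epsChar χ') := by
  constructor
  · intro e
    have := congrArg (reduceHom G hr) e
    rwa [reduceHom_conj, reduceHom_conj, reduceHom_omegaChar hpG hr hχ,
      reduceHom_omegaChar hpG hr hχ'] at this
  · intro e
    rw [conj_omegaChar, conj_omegaChar, e]

theorem commute_single_omegaChar (χ : LinChar p H K) {h : G} (hh : h ∈ H) :
    Commute (MonoidAlgebra.single h 1) (omegaChar r χ) := by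
  rw [← conj_eq_iff_commute, conj_omegaChar, conj_epsChar_of_mem χ hh, omegaChar]

theorem commute_omegaChar (χ : LinChar p H K) {y : MonoidAlgebra (ZMod (p ^ r)) G}
    (hy : ∀ h ∈ H, Commute (MonoidAlgebra.single h 1) y) : Commute (omegaChar r χ) y := by
  refine Commute.idemLift_left (commute_of_coeff_eq_zero (fun g hg => ?_) hy)
  rw [coeff_digitLift, coeff_epsChar_of_notMem χ hg, ZMod.val_zero, Nat.cast_zero]

/-- An idempotent above all `ω_C(H, K)` that is orthogonal to its conjugates outside the normalizer
of `K`. -/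
theorem exists_idempotent_above (hpG : ¬ p ∣ Fintype.card G) (hr : 1 ≤ r)
    (hHK : IsStrongShodaPair H K) :
    ∃ E : MonoidAlgebra (ZMod (p ^ r)) G,
      (∀ g, g ∉ Subgroup.normalizer (K : Set G) → E * conj g E = 0) ∧
      ∀ χ : LinChar p H K, IsFaithful χ →
        omegaChar r χ * E = omegaChar r χ ∧ E * omegaChar r χ = omegaChar r χ := by
  obtain ⟨P, c, hc, hPP, hPg, hcomm, hact⟩ := exists_integral_eps hHK
  set Q := MonoidAlgebra.mapRingHom G (Int.castRingHom (ZMod (p ^ r))) P with hQ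
  -- The primes dividing `c` divide `|G|`, hence differ from `p`; so `c` has an inverse `d` modulo
  -- `p ^ r`, and `d • Q` is the image of `ε(H,K)`.
  have hcp : Nat.Coprime c (p ^ r) := by
    refine Nat.Coprime.pow_right r (((Fact.out : p.Prime).coprime_iff_not_dvd.2 fun h => ?_).symm)
    exact hpG (hc p Fact.out h)
  obtain ⟨d, hd⟩ : ∃ d : ZMod (p ^ r), d * (c : ZMod (p ^ r)) = 1 :=
    ⟨(c : ZMod (p ^ r))⁻¹, by rw [mul_comm, ZMod.coe_mul_inv_eq_one c hcp]⟩
  have hQQ : Q * Q = (c : ZMod (p ^ r)) • Q := by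
    rw [hQ, ← map_mul, hPP, map_nsmul, Nat.cast_smul_eq_nsmul]
  have hE : IsIdempotentElem (d • Q) := by
    show d • Q * d • Q = d • Q
    rw [smul_mul_assoc, mul_smul_comm, hQQ, smul_smul d (c : ZMod (p ^ r)), hd, one_smul]
  refine ⟨d • Q, fun g hg => ?_, fun χ hχ => ?_⟩
  · rw [conj_smul, smul_mul_assoc, mul_smul_comm, hQ, ← map_conj, ← map_mul, hPg g hg, map_zero,
      smul_zero, smul_zero]
  · have hcω : Commute (d • Q) (omegaChar r χ) :=
      (hcomm _ _ fun h hh => commute_single_omegaChar χ hh).smul_left d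
    -- This product of commuting idempotents reduces to `ε_C (1 - E) = 0` modulo `p`, because `ε_C`
    -- is fixed by `K` and killed by the sums over larger subgroups, so that `P` acts on it as `c`.
    have key : omegaChar r χ * (1 - d • Q) = 0 := by
      refine eq_zero_of_reduceHom_eq_zero hr ?_ ?_
      · exact IsIdempotentElem.mul_of_commute ((Commute.one_right _).sub_right hcω.symm)
          (isIdempotentElem_omegaChar hpG hr hχ) hE.one_sub
      · have h1 := hact (ZMod p) (epsChar χ) (fun k hk => epsChar_mul_single χ hHK.le hk)
          fun L hK hL => epsChar_mul_subgroupSum hχ hK hL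
        have h2 : reduceHom G hr (d • Q) = ZMod.castHom
            (dvd_pow_self p (Nat.one_le_iff_ne_zero.mp hr)) (ZMod p) d •
              MonoidAlgebra.mapRingHom G (Int.castRingHom (ZMod p)) P := by
          rw [← map_intCast_eq_reduceHom hr]
          ext g
          rw [reduceHom, MonoidAlgebra.coeff_mapRingHom, MonoidAlgebra.coeff_smul_apply, smul_eq_mul,
            map_mul, MonoidAlgebra.coeff_smul_apply, MonoidAlgebra.coeff_mapRingHom, smul_eq_mul,
            MonoidAlgebra.coeff_mapRingHom, MonoidAlgebra.coeff_mapRingHom]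
        rw [map_mul, reduceHom_omegaChar hpG hr hχ, map_sub, map_one, h2, mul_sub, mul_one,
          mul_smul_comm, h1, ← Nat.cast_smul_eq_nsmul (ZMod p), smul_smul,
          ← map_natCast (ZMod.castHom (dvd_pow_self p (Nat.one_le_iff_ne_zero.mp hr)) (ZMod p)) c,
          ← map_mul, hd, map_one, one_smul, sub_self]
    have h3 : omegaChar r χ * (d • Q) = omegaChar r χ := by
      rw [mul_sub, mul_one, sub_eq_zero] at key
      exact key.symm
    exact ⟨h3, hcω.eq.trans h3⟩

theorem mem_iff_conj_mem (hHK : IsStrongShodaPair H K) {g : G}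
    (hg : g ∈ Subgroup.normalizer (K : Set G)) (h : G) : h ∈ H ↔ g * h * g⁻¹ ∈ H := by
  have key : ∀ x ∈ Subgroup.normalizer (K : Set G), ∀ h ∈ H, x * h * x⁻¹ ∈ H := fun x hx h hh =>
    hHK.normal_normalizer.conj_mem ⟨h, hHK.le_normalizer hh⟩ hh ⟨x, hx⟩
  exact ⟨key g hg h, fun hh => by simpa [mul_assoc] using key g⁻¹ (inv_mem hg) _ hh⟩

/-- The conjugates of `ω_C` and `ω_{C'}` are orthogonal, or equal through an element of the
normalizer of `K`. -/
theorem omegaChar_mul_conj (hpG : ¬ p ∣ Fintype.card G) (hr : 1 ≤ r)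
    (hHK : IsStrongShodaPair H K) {χ χ' : LinChar p H K} (hχ : IsFaithful χ)
    (hχ' : IsFaithful χ') (g : G) :
    omegaChar r χ' * conj g (omegaChar r χ) = 0 ∨
      g ∈ Subgroup.normalizer (K : Set G) ∧ omegaChar r χ' = conj g (omegaChar r χ) := by
  by_cases hg : g ∈ Subgroup.normalizer (K : Set G)
  · have hgH := mem_iff_conj_mem hHK hg
    rcases epsChar_mul_conj hpG hHK.toIsShodaPair hχ hχ' hgH with h | h
    · left
      refine eq_zero_of_reduceHom_eq_zero hr ?_ ?_
      · refine IsIdempotentElem.mul_of_commute (commute_omegaChar χ' ?_)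
          (isIdempotentElem_omegaChar hpG hr hχ')
          ((isIdempotentElem_omegaChar hpG hr hχ).map (conjHom g))
        exact commute_single_conj (fun h => (hgH h).1) fun h hh => commute_single_omegaChar χ hh
      · rw [map_mul, reduceHom_conj, reduceHom_omegaChar hpG hr hχ, reduceHom_omegaChar hpG hr hχ',
          h]
    · right
      refine ⟨hg, ?_⟩
      have := (conj_omegaChar_eq_iff hpG hr hχ' hχ 1 g).2 (by rwa [conj_one])
      rwa [conj_one] at this
  · left
    obtain ⟨E, hE, hω⟩ := exists_idempotent_above hpG hr hHK
    -- Writing `ω_{C'} = ω_{C'} E` and `ω_C = E ω_C` exposes the factor `E * conj g E = 0`.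
    rw [← (hω χ hχ).2, ← (hω χ' hχ').1, conj_mul, mul_assoc, ← mul_assoc E, hE g hg, zero_mul,
      mul_zero]

/-- Modulo `p`, either `f` or `1 - f` kills `ε_C`; the corresponding product with `ω_C` is an
idempotent reducing to zero. -/
theorem omegaChar_not_split (hpG : ¬ p ∣ Fintype.card G) (hr : 1 ≤ r) (hHK : IsShodaPair H K)
    {χ : LinChar p H K} (hχ : IsFaithful χ) {f : MonoidAlgebra (ZMod (p ^ r)) G}
    (hfc : f ∈ Subring.center (MonoidAlgebra (ZMod (p ^ r)) G)) (hf : IsIdempotentElem f) :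
    f * omegaChar r χ = 0 ∨ f * omegaChar r χ = omegaChar r χ := by
  have hω := isIdempotentElem_omegaChar hpG hr hχ
  have hc : Commute f (omegaChar r χ) := (Subring.mem_center_iff.1 hfc _).symm
  have key := mul_epsChar_eq_zero_or hpG hHK hχ (hf.map (reduceHom G hr)) fun h _ => by
    rw [← conj_eq_iff_commute, ← reduceHom_conj, (mem_center_iff_conj f).1 hfc]
  rcases key with h | h
  · left
    refine eq_zero_of_reduceHom_eq_zero hr (IsIdempotentElem.mul_of_commute hc hf hω) ?_
    rw [map_mul, reduceHom_omegaChar hpG hr hχ, h]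
  · right
    have h0 : (1 - f) * omegaChar r χ = 0 := by
      refine eq_zero_of_reduceHom_eq_zero hr
        (IsIdempotentElem.mul_of_commute ((Commute.one_left _).sub_left hc) hf.one_sub hω) ?_
      rw [map_mul, reduceHom_omegaChar hpG hr hχ, map_sub, map_one, sub_mul, one_mul, h, sub_self]
    rw [sub_mul, one_mul, sub_eq_zero] at h0
    exact h0.symm

end Main

end ShodaLift

theorem mainTheorem6 {G : Type*} [Group G] [Fintype G] (p : ℕ) [Fact p.Prime]
    (hpG : ¬ p ∣ Fintype.card G) (r : ℕ) (hr : 1 ≤ r)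
    (H K : Subgroup G) [(K.subgroupOf H).Normal] (hHK : ShodaLift.IsStrongShodaPair H K) :
    (∀ C ∈ ShodaLift.genClasses p H K,
      ShodaLift.cen (ShodaLift.omegaClass r C) = ShodaLift.cen (ShodaLift.epsClass C) ∧
      ShodaLift.reduce hr (ShodaLift.wClass r C) = ShodaLift.eClass C ∧
      ShodaLift.IsPrimitiveCentralIdempotent (ShodaLift.wClass r C)) ∧
    (∀ C ∈ ShodaLift.genClasses p H K, ∀ C' ∈ ShodaLift.genClasses p H K,
      (ShodaLift.wClass r C = ShodaLift.wClass r C' ↔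
        ∃ g ∈ Subgroup.normalizer (K : Set G), C' = ShodaLift.conjClass g C) ∧
      (ShodaLift.wClass r C ≠ ShodaLift.wClass r C' →
        ShodaLift.wClass r C * ShodaLift.wClass r C' = 0)) := by
  open ShodaLift in
  have hclass : ∀ C ∈ genClasses p H K, ∃ χ, IsFaithful χ ∧ C = cyclotomicClass χ ∧
      epsClass C = epsChar χ ∧ omegaClass r C = omegaChar r χ ∧
        wClass r C = sumConj (omegaChar r χ) := by
    intro C hC
    obtain ⟨χ, h1, h2, h3⟩ := exists_isFaithful hpG hHK.toIsShodaPair hC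
    refine ⟨χ, h1, h2, h3, ?_, ?_⟩
    · rw [omegaClass, h3, omegaChar]
    · rw [wClass, omegaClass, h3, omegaChar]
  constructor
  · intro C hC
    obtain ⟨χ, hχ, -, hε, hω, hw⟩ := hclass C hC
    have horth : ∀ g, omegaChar r χ * conj g (omegaChar r χ) = 0 ∨
        omegaChar r χ = conj g (omegaChar r χ) := fun g =>
      (omegaChar_mul_conj hpG hr hHK hχ hχ g).imp_right And.right
    refine ⟨?_, ?_, ?_⟩
    · rw [hω, hε]
      ext g
      have := conj_omegaChar_eq_iff hpG hr hχ hχ g 1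
      rwa [conj_one, conj_one] at this
    · rw [hw, eClass, hε]
      exact map_sumConj _ _ _ (reduceHom_omegaChar hpG hr hχ) fun g h =>
        (conj_omegaChar_eq_iff hpG hr hχ hχ g h).2
    · rw [hw]
      exact isPrimitiveCentralIdempotent_sumConj (isIdempotentElem_omegaChar hpG hr hχ)
        (omegaChar_ne_zero hpG hr hχ) horth fun f hfc hf =>
          omegaChar_not_split hpG hr hHK.toIsShodaPair hχ hfc hf
  · intro C hC C' hC'
    obtain ⟨χ, hχ, hCχ, hε, hω, hw⟩ := hclass C hC
    obtain ⟨χ', hχ', hCχ', hε', hω', hw'⟩ := hclass C' hC'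
    refine ⟨⟨fun h => ?_, ?_⟩, fun h => ?_⟩
    · rw [hw, hw'] at h
      -- Equal sums force some conjugate of `ω_C` to be non-orthogonal to `ω_{C'}`; the alternative
      -- then places `g` in `N_G(K)` and makes the two equal.
      obtain ⟨g, hg⟩ := exists_mul_conj_ne_zero_of_sumConj_eq (isIdempotentElem_omegaChar hpG hr hχ')
        (omegaChar_ne_zero hpG hr hχ')
        (fun g => (omegaChar_mul_conj hpG hr hHK hχ' hχ' g).imp_right And.right) h
      obtain ⟨hgN, he⟩ := (omegaChar_mul_conj hpG hr hHK hχ hχ' g).resolve_left hg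
      refine ⟨g, hgN, ?_⟩
      rw [hCχ, hCχ']
      refine conjClass_eq_of_epsChar_eq hpG hχ' (mem_iff_conj_mem hHK hgN) ?_
      have := (conj_omegaChar_eq_iff (r := r) hpG hr hχ' hχ 1 g).1 (by rwa [conj_one])
      rwa [conj_one] at this
    · rintro ⟨g, hgN, hCC'⟩
      have hmem : χ' ∈ conjClass g C := by
        rw [← hCC', hCχ']
        exact self_mem_cyclotomicClass χ'
      -- `χ'` is the `g`-conjugate of some `θ ∈ C`, possibly other than `χ`; this is harmless, since
      -- `ε_C` may be computed from any element of `C`.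
      obtain ⟨θ, hθ, hθ'⟩ := hmem
      have h1 : epsChar χ' = conj g (epsChar χ) := by
        rw [← hε, epsClass_eq hC hθ]
        exact (conj_epsChar_eq (mem_iff_conj_mem hHK hgN) hθ').symm
      have h2 := (conj_omegaChar_eq_iff (r := r) hpG hr hχ' hχ 1 g).2 (by rwa [conj_one])
      rw [conj_one] at h2
      rw [hw, hw', h2, sumConj_conj]
    · rw [hw, hw'] at h ⊢
      exact sumConj_mul_sumConj_eq_zero
        (fun g => (omegaChar_mul_conj hpG hr hHK hχ hχ' g).imp_right And.right) h
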